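/- Let $s\ge 1$, let $G_1,\dots,G_s$ be finite graphs with $G_i$ having vertex set $\{1,\dots,|V_i|\}$ and edge set $E_i$, where $G_1$ is a single edge on two vertices, and let $\beta_1\in\mathbb R$ and $\beta_2,\dots,\beta_s\ge 0$. For a graph $X$ on the vertex set $\{1,\dots,n\}$ let $N_{G}(X)$ be the number of injective maps from the vertices of $G$ to those of $X$ that send edges of $G$ to edges of $X$. Let $\mathcal G_n$ be the set of all graphs on $\{1,\dots,n\}$, with the Gibbs (exponential random graph) measure $$p_n(X)=\frac1{Z_n}\exp\Big(\sum_{i=1}^s\beta_i\frac{N_{G_i}(X)}{n^{|V_i|-2}}\Big),$$ where $Z_n$ is the normalizing constant. The Glauber dynamics is the Markov chain on $\mathcal G_n$ that, in each step, chooses one of the $\binom n2$ pairs $e$ of distinct vertices uniformly at random and moves from $X$ to $X\cup\{e\}$ or to $X\setminus\{e\}$ with probabilities proportional to $p_n(X\cup\{e\})$ and $p_n(X\setminus\{e\})$. The mixing time of a chain with stationary distribution $p_n$ is the least $t$ such that, from every starting state, the law after $t$ steps is within total variation distance $e^{-1}$ of $p_n$ ($\infty$ if there is no such $t$). Let $$\Psi(p)=\sum_{i=1}^s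 2\beta_i|E_i|p^{|E_i|-1},\qquad \varphi(p)=\frac{e^{\Psi(p)}}{1+e^{\Psi(p)}} .$$ **Theorem.** Suppose that there are at least two points $p^*\in[0,1]$ with $\varphi(p^*)=p^*$ and $\varphi'(p^*)<1$ (low temperature). Then there is a constant $c>0$, depending only on $G_1,\dots,G_s$ and $\beta_1,\dots,\beta_s$, such that: 1. for all sufficiently large $n$, the mixing time of the Glauber dynamics on $\mathcal G_n$ is at least $e^{cn}$; 2. more generally, if for each $n$ a Markov chain on $\mathcal G_n$ with stationary distribution $p_n$ is given, and these chains are local, i.e. there are $k_n=o(n)$ such that in each step at most $k_n$ edges of the graph change, then for all sufficiently large $n$ (depending on the sequence of chains) the mixing time of the $n$-th chain is at least $e^{cn}$. -/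

import Mathlib

namespace ERGM

open Filter

/-! ### The exponential random graph model -/

/-- A finite graph on a vertex set of the form `{1, …, m}`. -/
structure LabelledGraph where
  /-- the number of vertices -/
  order : ℕ
  /-- the graph itself -/
  graph : SimpleGraph (Fin order)

/-- The graph consisting of two vertices joined by an edge. -/
def edgeGraph : LabelledGraph := ⟨2, ⊤⟩

/-- The number of edges `|E|`. -/
noncomputable def LabelledGraph.size (G : LabelledGraph) : ℕ := G.graph.edgeSet.ncard

/-- The subgraph count `N_G(X)`: the number of tuples of distinct vertices `(v_1, …, v_m)` of `X`
such that `v_i v_j` is an edge of `X` whenever `i j` is an edge of `G`. -/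
noncomputable def subgraphCount (G : LabelledGraph) {n : ℕ} (X : SimpleGraph (Fin n)) : ℕ :=
  X.labelledCopyCount G.graph

/-- The Hamiltonian `H(X) = ∑ i, β_i N_{G_i}(X) / n ^ (|V_i| - 2)`. -/
noncomputable def hamiltonian {s : ℕ} (G : Fin (s + 1) → LabelledGraph) (β : Fin (s + 1) → ℝ)
    {n : ℕ} (X : SimpleGraph (Fin n)) : ℝ :=
  ∑ i, β i * ((subgraphCount (G i) X : ℝ) / (n : ℝ) ^ (((G i).order : ℤ) - 2))

/-- The Gibbs measure `p_n(X) = exp (H(X)) / Z_n`, as a function on the graphs on `n` vertices. -/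
noncomputable def gibbs {s : ℕ} (G : Fin (s + 1) → LabelledGraph) (β : Fin (s + 1) → ℝ)
    (n : ℕ) (X : SimpleGraph (Fin n)) : ℝ :=
  Real.exp (hamiltonian G β X) / ∑ Y : SimpleGraph (Fin n), Real.exp (hamiltonian G β Y)

/-- `Ψ(p) = ∑ i, 2 β_i |E_i| p ^ (|E_i| - 1)`; the term of a graph without edges is zero. -/
noncomputable def Psi {s : ℕ} (G : Fin (s + 1) → LabelledGraph) (β : Fin (s + 1) → ℝ)
    (p : ℝ) : ℝ :=
  ∑ i, 2 * β i * ((G i).size : ℝ) * p ^ ((G i).size - 1)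

/-- `φ(p) = exp (Ψ(p)) / (1 + exp (Ψ(p)))`. -/
noncomputable def phi {s : ℕ} (G : Fin (s + 1) → LabelledGraph) (β : Fin (s + 1) → ℝ)
    (p : ℝ) : ℝ :=
  Real.exp (Psi G β p) / (1 + Real.exp (Psi G β p))

/-- Low temperature: `φ` has at least two fixed points `p ∈ [0, 1]` with `φ'(p) < 1`. -/
def LowTemperature {s : ℕ} (G : Fin (s + 1) → LabelledGraph) (β : Fin (s + 1) → ℝ) : Prop :=
  {p : ℝ | p ∈ Set.Icc (0 : ℝ) 1 ∧ phi G β p = p ∧ deriv (phi G β) p < 1}.Nontrivial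

/-! ### Markov chains on a finite state space and their mixing time -/

/-- `P` is a transition matrix: nonnegative entries, and every row sums to one. -/
def IsTransitionMatrix {S : Type*} [Fintype S] (P : Matrix S S ℝ) : Prop :=
  (∀ x y, 0 ≤ P x y) ∧ ∀ x, ∑ y, P x y = 1

/-- The distribution `π` is stationary for `P`, that is, `π P = π`. -/
def IsStationary {S : Type*} [Fintype S] (P : Matrix S S ℝ) (π : S → ℝ) : Prop :=
  ∀ y, ∑ x, π x * P x y = π y

/-- Total variation distance of two probability distributions on a finite set. -/
noncomputable def tvDist {S : Type*} [Fintype S] (μ ν : S → ℝ) : ℝ :=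
  (∑ x, |μ x - ν x|) / 2

open Classical in
/-- The mixing time: the least `t` such that, from every starting state, the law of the chain
after `t` steps is within total variation distance `e⁻¹` of `π` (it is `⊤` if there is no such
`t`). -/
noncomputable def mixingTime {S : Type*} [Fintype S] (P : Matrix S S ℝ) (π : S → ℝ) : ℕ∞ :=
  sInf ((fun t : ℕ => (t : ℕ∞)) '' {t : ℕ | ∀ x, tvDist (fun y => (P ^ t) x y) π ≤ Real.exp (-1)})

/-! ### Glauber dynamics and local chains -/

/-- The graph `X_{e+}`: the edge `e` is present, all other edges are as in `X`. -/
def addEdge {n : ℕ} (X : SimpleGraph (Fin n)) (e : Sym2 (Fin n)) : SimpleGraph (Fin n) :=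
  X ⊔ SimpleGraph.fromEdgeSet {e}

/-- The graph `X_{e-}`: the edge `e` is absent, all other edges are as in `X`. -/
def removeEdge {n : ℕ} (X : SimpleGraph (Fin n)) (e : Sym2 (Fin n)) : SimpleGraph (Fin n) :=
  X.deleteEdges {e}

open Classical in
/-- The transition matrix of the Glauber dynamics: an edge `e` of the complete graph is chosen
uniformly at random, and the chain moves from `X` to `X_{e+}` or to `X_{e-}` with probabilities
proportional to `p_n(X_{e+})` and `p_n(X_{e-})`. -/
noncomputable def glauber {s : ℕ} (G : Fin (s + 1) → LabelledGraph) (β : Fin (s + 1) → ℝ)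
    (n : ℕ) : Matrix (SimpleGraph (Fin n)) (SimpleGraph (Fin n)) ℝ :=
  fun X Y => ((n.choose 2 : ℕ) : ℝ)⁻¹ * ∑ e ∈ (⊤ : SimpleGraph (Fin n)).edgeFinset,
    ((if Y = addEdge X e then
        gibbs G β n (addEdge X e) / (gibbs G β n (addEdge X e) + gibbs G β n (removeEdge X e))
      else 0) +
     (if Y = removeEdge X e then
        gibbs G β n (removeEdge X e) / (gibbs G β n (addEdge X e) + gibbs G β n (removeEdge X e))
      else 0))

/-- The number of edges in which two graphs on `n` vertices differ. -/
noncomputable def edgeDist {n : ℕ} (X Y : SimpleGraph (Fin n)) : ℕ :=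
  (symmDiff X.edgeSet Y.edgeSet).ncard

/-- A sequence of chains, the `n`-th one on the graphs on `n` vertices, is local if at most `o(n)`
edges change in each step. -/
def IsLocal (P : (n : ℕ) → Matrix (SimpleGraph (Fin n)) (SimpleGraph (Fin n)) ℝ) : Prop :=
  ∃ k : ℕ → ℕ, (fun n => (k n : ℝ)) =o[atTop] (fun n : ℕ => (n : ℝ)) ∧
    ∀ᶠ n in atTop, ∀ X Y, P n X Y ≠ 0 → edgeDist X Y ≤ k n

end ERGM

/-!
Two stable fixed points `p₁ < p₂` of `φ` yield levels `p₁ < x < y < p₂` with `φ x < x` and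
`y < φ y`. Let the *local field* of a graph `X` at a pair `e` be the increment of the Hamiltonian
when `e` is added to `X` (`field`). Conditionally on all other edges, `e` is present with
probability `exp h / (1 + exp h)`, where `h` is the local field at `e`. The two *wells* are the set
of graphs all of whose local fields are at most `Ψ x`, and the set of graphs all of whose local
fields are at least `Ψ y` (`well`). They are disjoint, so one of them has Gibbs mass at most `1/2`,
and it suffices to show that a local chain takes exponentially long to leave it.

Take the lower well. Since `β i ≥ 0` for `i ≠ 0`, local fields increase with the graph and the well
is a decreasing set. Hence, under the Gibbs measure conditioned on the well, each edge is present
with conditional probability at most `q = φ x`, whatever the other edges are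
(`well_conditional_le`). A local field is a multilinear polynomial in the edge indicators with
nonnegative slopes, so that the indicators can be replaced one after the other by the number `q` at
the price of a sub-Gaussian factor (`sum_mul_exp_partialDeriv_le`). This bounds the exponential
moments of a local field by those of a variable with mean about `Ψ q` and variance of order `1 / n`:
a single pair has influence `O(1 / n)` on the field, and the influences of all pairs add up to
`O(1)` (`exists_pairWeight_le`). As `Ψ q < Ψ x`, the graphs in the well with some local field a
fixed amount above `Ψ q` have relative mass `n ^ 2 * exp (-c n)` (`exists_shell_le`). A step
that changes `o(n)` edges changes the local fields by `o(1)` (`IsLocal.eventually_mem_well`),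
so that a local chain can leave the well through this shell only, which takes an exponential time
(`le_mul_of_barrier`). The upper well is treated in the same way; a sign `σ = ±1` covers both.
No reversibility and no coupling is needed, and the Glauber dynamics is a special case.
-/

namespace ERGM

open Filter Finset

/-! ### Barriers and mixing times -/

section Barrier

variable {S : Type*} [Fintype S] [DecidableEq S] {P : Matrix S S ℝ} {π : S → ℝ}

theorem IsTransitionMatrix.pow (hP : IsTransitionMatrix P) (t : ℕ) :
    IsTransitionMatrix (P ^ t) := by
  induction t with
  | zero =>
    refine ⟨fun x y => ?_, fun x => ?_⟩
    · rw [pow_zero, Matrix.one_apply]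
      split_ifs <;> norm_num
    · simp [Matrix.one_apply]
  | succ t ih =>
    refine ⟨fun x y => ?_, fun x => ?_⟩
    · rw [pow_succ, Matrix.mul_apply]
      exact sum_nonneg fun z _ => mul_nonneg (ih.1 _ _) (hP.1 _ _)
    · simp_rw [pow_succ, Matrix.mul_apply]
      rw [sum_comm]
      simp_rw [← mul_sum, hP.2, mul_one]
      exact ih.2 x

theorem IsStationary.pow (hπ : IsStationary P π) (t : ℕ) : IsStationary (P ^ t) π := by
  induction t with
  | zero => intro y; simp [Matrix.one_apply]
  | succ t ih =>
    intro y
    simp_rw [pow_succ, Matrix.mul_apply, mul_sum]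
    rw [sum_comm]
    simp_rw [← mul_assoc, ← sum_mul]
    rw [← hπ y]
    exact sum_congr rfl fun z _ => by rw [ih z]

/-- The stationary flow out of `A` in `t` steps is at most `t π(B)` if the chain can leave `A` only
through `B`. -/
theorem flow_compl_le (hP : IsTransitionMatrix P) (hπ : IsStationary P π) (hπ0 : ∀ x, 0 ≤ π x)
    {A B : Finset S} (hAB : ∀ x ∈ A, x ∉ B → ∀ y, P x y ≠ 0 → y ∈ A) (t : ℕ) :
    ∑ x ∈ A, π x * ∑ y ∈ Aᶜ, (P ^ t) x y ≤ t * ∑ x ∈ B, π x := by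
  induction t with
  | zero =>
    refine le_of_eq ?_
    simp only [pow_zero, Nat.cast_zero, zero_mul]
    refine sum_eq_zero fun x hx => mul_eq_zero_of_right _ (sum_eq_zero fun y hy => ?_)
    rw [Matrix.one_apply_ne]
    rintro rfl
    exact (mem_compl.mp hy) hx
  | succ t ih =>
    have hout : ∀ z, ∑ y ∈ Aᶜ, P z y ≤ 1 := fun z =>
      (sum_le_univ_sum_of_nonneg (hP.1 z)).trans_eq (hP.2 z)
    have hout0 : ∀ z, 0 ≤ ∑ y ∈ Aᶜ, P z y := fun z => sum_nonneg fun y _ => hP.1 z y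
    have hmass : ∀ z, ∑ x ∈ A, π x * (P ^ t) x z ≤ π z := fun z => by
      rw [← hπ.pow t z]
      exact sum_le_univ_sum_of_nonneg fun x => mul_nonneg (hπ0 x) ((hP.pow t).1 x z)
    have hmass0 : ∀ z, 0 ≤ ∑ x ∈ A, π x * (P ^ t) x z := fun z =>
      sum_nonneg fun x _ => mul_nonneg (hπ0 x) ((hP.pow t).1 x z)
    have hsplit : ∑ x ∈ A, π x * ∑ y ∈ Aᶜ, (P ^ (t + 1)) x y
        = ∑ z, (∑ x ∈ A, π x * (P ^ t) x z) * ∑ y ∈ Aᶜ, P z y := by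
      simp_rw [pow_succ, Matrix.mul_apply, sum_mul]
      rw [sum_comm]
      refine sum_congr rfl fun x _ => ?_
      rw [sum_comm]
      simp_rw [← mul_sum, mul_assoc, ← mul_sum]
    rw [hsplit, ← sum_add_sum_compl A, Nat.cast_succ, add_mul, one_mul, add_comm]
    refine add_le_add (le_trans ?_ ih) ?_
    · calc ∑ z ∈ Aᶜ, (∑ x ∈ A, π x * (P ^ t) x z) * ∑ y ∈ Aᶜ, P z y
          ≤ ∑ z ∈ Aᶜ, ∑ x ∈ A, π x * (P ^ t) x z :=
            sum_le_sum fun z _ => mul_le_of_le_one_right (hmass0 z) (hout z)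
        _ = _ := by rw [sum_comm]; simp_rw [mul_sum]
    · calc ∑ z ∈ A, (∑ x ∈ A, π x * (P ^ t) x z) * ∑ y ∈ Aᶜ, P z y
          ≤ ∑ z ∈ A, if z ∈ B then π z else 0 := by
            refine sum_le_sum fun z hz => ?_
            split_ifs with hzB
            · exact (mul_le_of_le_one_right (hmass0 z) (hout z)).trans (hmass z)
            · refine (mul_eq_zero_of_right _ (sum_eq_zero fun y hy => ?_)).le
              by_contra hne
              exact (mem_compl.mp hy) (hAB z hz hzB y hne)
        _ ≤ ∑ z, if z ∈ B then π z else 0 :=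
            sum_le_univ_sum_of_nonneg fun z => by split_ifs; exacts [hπ0 z, le_rfl]
        _ = ∑ z ∈ B, π z := by rw [sum_ite_mem, univ_inter]

/-- A set of stationary mass at most `1/2` that is left only through a set of relative mass `δ` is
not left within a time much shorter than `1/δ`, so that the chain cannot mix before. -/
theorem le_mul_of_barrier (hP : IsTransitionMatrix P) (hπ : IsStationary P π)
    (hπ0 : ∀ x, 0 ≤ π x) (hπ1 : ∑ x, π x = 1) {A B : Finset S}
    (hAB : ∀ x ∈ A, x ∉ B → ∀ y, P x y ≠ 0 → y ∈ A) (hA : 0 < ∑ x ∈ A, π x)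
    (hA2 : ∑ x ∈ A, π x ≤ 1 / 2) {δ : ℝ} (hB : ∑ x ∈ B, π x ≤ δ * ∑ x ∈ A, π x) {t : ℕ}
    (ht : ∀ x, tvDist (fun y => (P ^ t) x y) π ≤ Real.exp (-1)) :
    1 / 2 - Real.exp (-1) ≤ t * δ := by
  have hexit : ∀ x, 1 / 2 - Real.exp (-1) ≤ ∑ y ∈ Aᶜ, (P ^ t) x y := by
    intro x
    have h1 := ht x
    unfold tvDist at h1
    have h2 : ∑ y ∈ A, (P ^ t) x y - ∑ y ∈ A, π y ≤ ∑ y ∈ A, |(P ^ t) x y - π y| := by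
      rw [← sum_sub_distrib]
      exact sum_le_sum fun y _ => le_abs_self _
    have h3 : ∑ y ∈ Aᶜ, π y - ∑ y ∈ Aᶜ, (P ^ t) x y ≤ ∑ y ∈ Aᶜ, |(P ^ t) x y - π y| := by
      rw [← sum_sub_distrib]
      exact sum_le_sum fun y _ => by rw [abs_sub_comm]; exact le_abs_self _
    have h4 := (hP.pow t).2 x
    rw [← sum_add_sum_compl A] at h1 h4 hπ1
    linarith
  have hflow := flow_compl_le hP hπ hπ0 hAB t
  have hlow : (1 / 2 - Real.exp (-1)) * ∑ x ∈ A, π x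
      ≤ ∑ x ∈ A, π x * ∑ y ∈ Aᶜ, (P ^ t) x y := by
    rw [mul_sum]
    exact sum_le_sum fun x _ => by
      rw [mul_comm]; exact mul_le_mul_of_nonneg_left (hexit x) (hπ0 x)
  have : (1 / 2 - Real.exp (-1)) * ∑ x ∈ A, π x ≤ (t * δ) * ∑ x ∈ A, π x := by
    refine hlow.trans (hflow.trans ?_)
    rw [mul_assoc]
    exact mul_le_mul_of_nonneg_left hB (Nat.cast_nonneg t)
  exact le_of_mul_le_mul_right this hA

end Barrier

theorem ofReal_le_mixingTime {S : Type*} [Fintype S] {P : Matrix S S ℝ} {π : S → ℝ} {r : ℝ}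
    (h : ∀ t : ℕ, (∀ x, by classical exact tvDist (fun y => (P ^ t) x y) π ≤ Real.exp (-1)) →
      r ≤ t) : ENNReal.ofReal r ≤ (mixingTime P π : ENNReal) := by
  classical
  unfold mixingTime
  rcases Set.eq_empty_or_nonempty ((fun t : ℕ => (t : ℕ∞)) ''
    {t : ℕ | ∀ x, tvDist (fun y => (P ^ t) x y) π ≤ Real.exp (-1)}) with he | hne
  · simp [he]
  · obtain ⟨t, ht, hte⟩ := csInf_mem hne
    simp only at hte
    rw [← hte]
    have := h t (fun x => by convert ht x)
    rw [ENat.toENNReal_coe, ← ENNReal.ofReal_natCast]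
    exact ENNReal.ofReal_le_ofReal this

/-! ### Multilinear polynomials -/

section Multilinear

variable {ι J : Type*} [DecidableEq ι] [Fintype J]

/-- The multilinear polynomial `∑ j, w j * ∏ f ∈ S j, x f`. -/
def multilinear (w : J → ℝ) (S : J → Finset ι) (x : ι → ℝ) : ℝ := ∑ j, w j * ∏ f ∈ S j, x f

/-- The partial derivative of `multilinear w S` in the variable `e`. -/
def partialDeriv (w : J → ℝ) (S : J → Finset ι) (e : ι) (x : ι → ℝ) : ℝ :=
  ∑ j, if e ∈ S j then w j * ∏ f ∈ (S j).erase e, x f else 0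

/-- The total absolute weight of the monomials that contain both of the distinct variables `e` and
`f` (and `0` if `e = f`): a bound for the mixed second derivative on the unit cube. -/
def pairWeight (w : J → ℝ) (S : J → Finset ι) (e f : ι) : ℝ :=
  ∑ j, if e ∈ S j ∧ f ∈ (S j).erase e then |w j| else 0

variable {w : J → ℝ} {S : J → Finset ι}

theorem pairWeight_nonneg (e f : ι) : 0 ≤ pairWeight w S e f :=
  sum_nonneg fun j _ => by split_ifs; exacts [abs_nonneg _, le_rfl]

theorem multilinear_sub_multilinear {e : ι} {x y : ι → ℝ} (hxy : ∀ f, f ≠ e → x f = y f)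
    (hx : x e = 1) (hy : y e = 0) :
    multilinear w S x - multilinear w S y = partialDeriv w S e x := by
  unfold multilinear partialDeriv
  rw [← sum_sub_distrib]
  refine sum_congr rfl fun j _ => ?_
  split_ifs with h
  · rw [prod_eq_zero h hy, ← mul_prod_erase _ _ h, hx]
    ring
  · rw [prod_congr rfl fun f hf => hxy f (by rintro rfl; exact h hf), sub_self]

theorem partialDeriv_congr {e : ι} {x y : ι → ℝ}
    (hxy : ∀ j, e ∈ S j → ∀ f ∈ S j, f ≠ e → x f = y f) :
    partialDeriv w S e x = partialDeriv w S e y := by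
  refine sum_congr rfl fun j _ => ?_
  split_ifs with h
  · rw [prod_congr rfl fun f hf => hxy j h f (mem_of_mem_erase hf) (ne_of_mem_erase hf)]
  · rfl

theorem partialDeriv_mono (hw : ∀ j, 0 ≤ w j ∨ (S j).card ≤ 1) {e : ι} {x y : ι → ℝ}
    (hx : ∀ f, 0 ≤ x f) (hxy : ∀ f, x f ≤ y f) :
    partialDeriv w S e x ≤ partialDeriv w S e y := by
  refine sum_le_sum fun j _ => ?_
  split_ifs with h
  · rcases hw j with hj | hj
    · exact mul_le_mul_of_nonneg_left (prod_le_prod (fun f _ => hx f) fun f _ => hxy f) hj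
    · have : (S j).erase e = ∅ := by
        rw [← card_eq_zero, card_erase_of_mem h]; omega
      simp [this]
  · exact le_rfl

/-- A partial derivative of a multilinear polynomial is affine in each variable, with a slope that
is nonnegative if all coefficients of degree at least two are. -/
theorem partialDeriv_update (hw : ∀ j, 0 ≤ w j ∨ (S j).card ≤ 1) (e f : ι) {x : ι → ℝ}
    (hx : ∀ g, x g ∈ Set.Icc (0 : ℝ) 1) :
    ∃ Δ : ℝ, 0 ≤ Δ ∧ Δ ≤ pairWeight w S e f ∧ ∀ r,
      partialDeriv w S e (Function.update x f r) = partialDeriv w S e x + (r - x f) * Δ := by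
  have hprod0 : ∀ T : Finset ι, 0 ≤ ∏ g ∈ T, x g := fun T => prod_nonneg fun g _ => (hx g).1
  have hprod1 : ∀ T : Finset ι, ∏ g ∈ T, x g ≤ 1 := fun T =>
    prod_le_one (fun g _ => (hx g).1) fun g _ => (hx g).2
  refine ⟨∑ j, if e ∈ S j ∧ f ∈ (S j).erase e then
    w j * ∏ g ∈ ((S j).erase e).erase f, x g else 0, ?_, ?_, fun r => ?_⟩
  · refine sum_nonneg fun j _ => ?_
    split_ifs with h
    · rcases hw j with hj | hj
      · exact mul_nonneg hj (hprod0 _)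
      · have := card_pos.mpr ⟨f, h.2⟩
        rw [card_erase_of_mem h.1] at this
        omega
    · exact le_rfl
  · refine sum_le_sum fun j _ => ?_
    split_ifs with h
    · calc w j * ∏ g ∈ ((S j).erase e).erase f, x g
          ≤ |w j| * ∏ g ∈ ((S j).erase e).erase f, x g :=
            mul_le_mul_of_nonneg_right (le_abs_self _) (hprod0 _)
        _ ≤ |w j| := mul_le_of_le_one_right (abs_nonneg _) (hprod1 _)
    · exact le_rfl
  · unfold partialDeriv
    rw [mul_sum, ← sum_add_distrib]
    refine sum_congr rfl fun j _ => ?_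
    by_cases he : e ∈ S j
    · by_cases hf : f ∈ (S j).erase e
      · rw [if_pos he, if_pos he, if_pos ⟨he, hf⟩, ← mul_prod_erase _ _ hf,
          ← mul_prod_erase _ x hf, Function.update_self,
          prod_congr rfl fun g hg => Function.update_of_ne (ne_of_mem_erase hg) r x]
        ring
      · rw [if_pos he, if_pos he, if_neg (fun h => hf h.2),
          prod_congr rfl fun g hg => Function.update_of_ne
            (ne_of_mem_of_not_mem hg hf) r x]
        ring
    · rw [if_neg he, if_neg he, if_neg (fun h => he h.1)]
      ring

theorem abs_partialDeriv_sub_le (e : ι) {x y : ι → ℝ}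
    (hx : ∀ g, x g ∈ Set.Icc (0 : ℝ) 1) (hy : ∀ g, y g ∈ Set.Icc (0 : ℝ) 1) [Fintype ι] :
    |partialDeriv w S e x - partialDeriv w S e y| ≤ ∑ f, |x f - y f| * pairWeight w S e f := by
  have hprod : ∀ T : Finset ι, |∏ g ∈ T, x g - ∏ g ∈ T, y g| ≤ ∑ g ∈ T, |x g - y g| := by
    intro T
    induction T using Finset.induction_on with
    | empty => simp
    | insert a T ha ih =>
      rw [prod_insert ha, prod_insert ha, sum_insert ha]
      have h1 : |x a| ≤ 1 := abs_le.mpr ⟨by linarith [(hx a).1], (hx a).2⟩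
      have h2 : |∏ g ∈ T, y g| ≤ 1 := by
        rw [abs_of_nonneg (prod_nonneg fun g _ => (hy g).1)]
        exact prod_le_one (fun g _ => (hy g).1) fun g _ => (hy g).2
      calc |x a * ∏ g ∈ T, x g - y a * ∏ g ∈ T, y g|
          = |(x a - y a) * ∏ g ∈ T, y g + x a * (∏ g ∈ T, x g - ∏ g ∈ T, y g)| := by
            congr 1; ring
        _ ≤ |x a - y a| * |∏ g ∈ T, y g| + |x a| * |∏ g ∈ T, x g - ∏ g ∈ T, y g| := by
            rw [← abs_mul, ← abs_mul]; exact abs_add_le _ _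
        _ ≤ |x a - y a| + ∑ g ∈ T, |x g - y g| :=
            add_le_add (mul_le_of_le_one_right (abs_nonneg _) h2)
              ((mul_le_of_le_one_left (abs_nonneg _) h1).trans ih)
  unfold partialDeriv pairWeight
  simp_rw [mul_sum]
  rw [sum_comm, ← sum_sub_distrib]
  refine (abs_sum_le_sum_abs _ _).trans (sum_le_sum fun j _ => ?_)
  by_cases he : e ∈ S j
  · simp only [he, if_true, true_and]
    rw [← mul_sub, abs_mul]
    calc |w j| * |∏ f ∈ (S j).erase e, x f - ∏ f ∈ (S j).erase e, y f|
        ≤ |w j| * ∑ f ∈ (S j).erase e, |x f - y f| :=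
          mul_le_mul_of_nonneg_left (hprod _) (abs_nonneg _)
      _ = _ := by
          rw [mul_sum]
          simp_rw [mul_ite, mul_zero, mul_comm |w j|]
          rw [sum_ite_mem, univ_inter]
  · simp [he]

end Multilinear

/-! ### Comparison with a product measure -/

/-- The coordinates of a graph: `1` for the edges, `0` for the other pairs. -/
noncomputable def coord {n : ℕ} (X : SimpleGraph (Fin n)) (e : Sym2 (Fin n)) : ℝ :=
  X.edgeSet.indicator 1 e

section Toggle

variable {n : ℕ} {X : SimpleGraph (Fin n)} {e f : Sym2 (Fin n)}

theorem edgeSet_addEdge (he : ¬ e.IsDiag) : (addEdge X e).edgeSet = insert e X.edgeSet := by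
  ext f
  simp only [addEdge, SimpleGraph.edgeSet_sup, SimpleGraph.edgeSet_fromEdgeSet, Set.mem_union,
    Set.mem_sdiff, Set.mem_singleton_iff, Set.mem_insert_iff]
  constructor
  · rintro (h | ⟨h, -⟩)
    exacts [.inr h, .inl h]
  · rintro (rfl | h)
    exacts [.inr ⟨rfl, he⟩, .inl h]

theorem edgeSet_removeEdge : (removeEdge X e).edgeSet = X.edgeSet \ {e} :=
  SimpleGraph.edgeSet_deleteEdges _

theorem addEdge_of_mem (he : e ∈ X.edgeSet) : addEdge X e = X := by
  rw [← SimpleGraph.edgeSet_inj, edgeSet_addEdge (X.not_isDiag_of_mem_edgeSet he),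
    Set.insert_eq_of_mem he]

theorem removeEdge_of_notMem (he : e ∉ X.edgeSet) : removeEdge X e = X := by
  rw [← SimpleGraph.edgeSet_inj, edgeSet_removeEdge, Set.sdiff_singleton_eq_self he]

theorem removeEdge_addEdge (hd : ¬ e.IsDiag) (he : e ∉ X.edgeSet) :
    removeEdge (addEdge X e) e = X := by
  rw [← SimpleGraph.edgeSet_inj, edgeSet_removeEdge, edgeSet_addEdge hd,
    Set.insert_sdiff_self_of_notMem he]

theorem addEdge_removeEdge (he : e ∈ X.edgeSet) : addEdge (removeEdge X e) e = X := by
  rw [← SimpleGraph.edgeSet_inj, edgeSet_addEdge (X.not_isDiag_of_mem_edgeSet he),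
    edgeSet_removeEdge, Set.insert_sdiff_singleton, Set.insert_eq_of_mem he]

theorem coord_mem_Icc : coord X e ∈ Set.Icc (0 : ℝ) 1 := by
  unfold coord Set.indicator
  split_ifs <;> simp

theorem coord_addEdge_of_ne (hd : ¬ e.IsDiag) (hfe : f ≠ e) : coord (addEdge X e) f = coord X f := by
  classical
  simp [coord, edgeSet_addEdge hd, Set.indicator_apply, hfe]

theorem coord_of_mem (h : e ∈ X.edgeSet) : coord X e = 1 := Set.indicator_of_mem h _

theorem coord_of_notMem (h : e ∉ X.edgeSet) : coord X e = 0 := Set.indicator_of_notMem h _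

theorem coord_addEdge_self (hd : ¬ e.IsDiag) : coord (addEdge X e) e = 1 :=
  coord_of_mem (by rw [edgeSet_addEdge hd]; exact Set.mem_insert _ _)

open Classical in
/-- Graphs are summed over in pairs that differ in the edge `e` only. -/
theorem sum_eq_sum_pair (hd : ¬ e.IsDiag) (g : SimpleGraph (Fin n) → ℝ) :
    ∑ X, g X = ∑ X with e ∉ X.edgeSet, (g (addEdge X e) + g X) := by
  rw [sum_add_distrib, ← sum_filter_add_sum_filter_not univ (fun X => e ∈ X.edgeSet)]
  congr 1
  refine sum_nbij' (fun X => removeEdge X e) (fun X => addEdge X e) ?_ ?_ ?_ ?_ ?_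
  · intro X _
    simp [edgeSet_removeEdge]
  · intro X _
    simp [edgeSet_addEdge hd]
  · intro X hX
    exact addEdge_removeEdge (mem_filter.mp hX).2
  · intro X hX
    exact removeEdge_addEdge hd (mem_filter.mp hX).2
  · intro X hX
    rw [addEdge_removeEdge (mem_filter.mp hX).2]

end Toggle

theorem exp_le_add_exp_sq (t : ℝ) : Real.exp t ≤ t + Real.exp (t ^ 2) := by
  have hsq := Real.add_one_le_exp (t ^ 2)
  rcases le_or_gt |t| 1 with h | h
  · have := (abs_le.mp (Real.abs_exp_sub_one_sub_id_le h)).2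
    linarith
  · rcases lt_abs.mp h with h | h
    · have : Real.exp t ≤ Real.exp (t ^ 2) := Real.exp_le_exp.mpr (by nlinarith)
      linarith
    · have : Real.exp t ≤ 1 := Real.exp_le_one_iff.mpr (by linarith)
      nlinarith

/-- A two-point version of Hoeffding's lemma for a law that is biased, in the direction of
`-lam`, compared with the Bernoulli law of parameter `q`. -/
theorem two_point_exp_le {a b q lam Δ c : ℝ} (ha : 0 ≤ a) (hb : 0 ≤ b) (hq0 : 0 ≤ q) (hq1 : q ≤ 1)
    (hΔ : 0 ≤ Δ) (hc : Δ ≤ c) (hab : lam * ((1 - q) * b - q * a) ≤ 0) :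
    b * Real.exp (lam * ((1 - q) * Δ)) + a * Real.exp (lam * ((0 - q) * Δ))
      ≤ (b + a) * Real.exp (lam ^ 2 * c ^ 2) := by
  have key : ∀ r : ℝ, r ^ 2 ≤ 1 →
      Real.exp (lam * (r * Δ)) ≤ lam * (r * Δ) + Real.exp (lam ^ 2 * c ^ 2) := by
    intro r hr
    refine (exp_le_add_exp_sq _).trans (add_le_add le_rfl (Real.exp_le_exp.mpr ?_))
    have h1 : Δ ^ 2 ≤ c ^ 2 := pow_le_pow_left₀ hΔ hc 2
    calc (lam * (r * Δ)) ^ 2 = lam ^ 2 * (r ^ 2 * Δ ^ 2) := by ring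
      _ ≤ lam ^ 2 * (1 * c ^ 2) := by gcongr
      _ = _ := by ring
  have h1 := mul_le_mul_of_nonneg_left (key (1 - q) (by nlinarith)) hb
  have h2 := mul_le_mul_of_nonneg_left (key (0 - q) (by nlinarith)) ha
  have h3 := mul_le_mul_of_nonneg_right hab hΔ
  nlinarith

open Classical in
/-- Let `μ` be a measure on graphs under which, conditionally on all other edges, each edge is
present with probability at most `q` (if `lam ≥ 0`), or at least `q` (if `lam ≤ 0`). Then the
exponential moments of a partial derivative of a multilinear polynomial are at most those of a
sub-Gaussian variable centred at its mean under independent edges of density `q`. The coordinates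
are replaced by `q` one after the other. -/
theorem sum_mul_exp_partialDeriv_le {n : ℕ} {J : Type*} [Fintype J] {w : J → ℝ}
    {S : J → Finset (Sym2 (Fin n))} (hw : ∀ j, 0 ≤ w j ∨ (S j).card ≤ 1) (e : Sym2 (Fin n))
    {μ : SimpleGraph (Fin n) → ℝ} (hμ : ∀ X, 0 ≤ μ X) {q lam : ℝ} (hq0 : 0 ≤ q) (hq1 : q ≤ 1)
    (hμq : ∀ X, ∀ f ∉ X.edgeSet, ¬ f.IsDiag →
      lam * ((1 - q) * μ (addEdge X f) - q * μ X) ≤ 0)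
    (T : Finset (Sym2 (Fin n))) (hT : ∀ f ∈ T, ¬ f.IsDiag) :
    ∑ X, μ X * Real.exp (lam * partialDeriv w S e (fun f => if f ∈ T then coord X f else q)) ≤
      Real.exp (lam * partialDeriv w S e (fun _ => q) +
        lam ^ 2 * ∑ f ∈ T, pairWeight w S e f ^ 2) * ∑ X, μ X := by
  induction T using Finset.induction_on with
  | empty => simp [← sum_mul, mul_comm]
  | insert f T hf ih =>
    have hd : ¬ f.IsDiag := hT f (mem_insert_self _ _)
    specialize ih fun g hg => hT g (mem_insert_of_mem hg)
    have hstep : ∑ X, μ X * Real.exp (lam * partialDeriv w S e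
          (fun g => if g ∈ insert f T then coord X g else q))
        ≤ ∑ X, μ X * Real.exp (lam * partialDeriv w S e (fun g => if g ∈ T then coord X g else q)) *
          Real.exp (lam ^ 2 * pairWeight w S e f ^ 2) := by
      rw [sum_eq_sum_pair hd, sum_eq_sum_pair hd]
      refine sum_le_sum fun X hX => ?_
      have hfX : f ∉ X.edgeSet := (mem_filter.mp hX).2
      set x : Sym2 (Fin n) → ℝ := fun g => if g ∈ T then coord X g else q with hx
      have hxI : ∀ g, x g ∈ Set.Icc (0 : ℝ) 1 := fun g => by
        simp only [hx]
        split_ifs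
        exacts [coord_mem_Icc, ⟨hq0, hq1⟩]
      have hxf : x f = q := if_neg hf
      obtain ⟨Δ, hΔ0, hΔ1, hΔ⟩ := partialDeriv_update hw e f hxI
      have h0 : (fun g => if g ∈ insert f T then coord X g else q) = Function.update x f 0 := by
        ext g
        rcases eq_or_ne g f with rfl | hg
        · simp [coord_of_notMem hfX]
        · simp [hg, hx]
      have h1 : (fun g => if g ∈ insert f T then coord (addEdge X f) g else q)
          = Function.update x f 1 := by
        ext g
        rcases eq_or_ne g f with rfl | hg
        · simp [coord_addEdge_self hd]
        · simp [hg, hx, coord_addEdge_of_ne hd hg]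
      have h2 : (fun g => if g ∈ T then coord (addEdge X f) g else q) = x := by
        ext g
        rcases eq_or_ne g f with rfl | hg
        · simp [hf, hx]
        · simp [hx, coord_addEdge_of_ne hd hg]
      rw [h0, h1, h2, hΔ, hΔ, hxf, mul_add, mul_add, Real.exp_add, Real.exp_add]
      have := two_point_exp_le (hμ X) (hμ (addEdge X f)) hq0 hq1 hΔ0 hΔ1 (hμq X f hfX hd)
      have := mul_le_mul_of_nonneg_left this (Real.exp_pos (lam * partialDeriv w S e x)).le
      linarith
    rw [← sum_mul] at hstep
    refine hstep.trans ((mul_le_mul_of_nonneg_right ih (Real.exp_pos _).le).trans_eq ?_)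
    rw [sum_insert hf, mul_add, Real.exp_add, Real.exp_add, Real.exp_add]
    ring

/-! ### Counting embeddings -/

section Embeddings

variable {n : ℕ}

open Classical in
/-- The image of the edge set of `H` under an injection of its vertices. -/
noncomputable def imageEdges (H : LabelledGraph) (φ : Fin H.order ↪ Fin n) :
    Finset (Sym2 (Fin n)) :=
  H.graph.edgeFinset.map φ.sym2Map

theorem mem_imageEdges {H : LabelledGraph} {φ : Fin H.order ↪ Fin n} {e : Sym2 (Fin n)} :
    e ∈ imageEdges H φ ↔ ∃ a ∈ H.graph.edgeSet, Sym2.map φ a = e := by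
  simp [imageEdges]

theorem not_isDiag_of_mem_imageEdges {H : LabelledGraph} {φ : Fin H.order ↪ Fin n}
    {e : Sym2 (Fin n)} (he : e ∈ imageEdges H φ) : ¬ e.IsDiag := by
  obtain ⟨a, ha, rfl⟩ := mem_imageEdges.mp he
  rw [Sym2.isDiag_map φ.injective]
  exact H.graph.not_isDiag_of_mem_edgeSet ha

theorem card_imageEdges (H : LabelledGraph) (φ : Fin H.order ↪ Fin n) :
    (imageEdges H φ).card = H.size := by
  classical
  rw [imageEdges, card_map, LabelledGraph.size, Set.ncard_eq_toFinset_card']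
  rfl

theorem mem_range_of_mem_imageEdges {H : LabelledGraph} {φ : Fin H.order ↪ Fin n}
    {e : Sym2 (Fin n)} (he : e ∈ imageEdges H φ) {v : Fin n} (hv : v ∈ e) : ∃ a, φ a = v := by
  obtain ⟨a, -, rfl⟩ := mem_imageEdges.mp he
  obtain ⟨b, -, rfl⟩ := Sym2.mem_map.mp hv
  exact ⟨b, rfl⟩

open Classical in
theorem subgraphCount_eq (H : LabelledGraph) (X : SimpleGraph (Fin n)) :
    subgraphCount H X
      = (univ.filter fun φ : Fin H.order ↪ Fin n => ∀ e ∈ imageEdges H φ, e ∈ X.edgeSet).card := by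
  let toSub : SimpleGraph.Copy H.graph X ≃
      {φ : Fin H.order ↪ Fin n // ∀ e ∈ imageEdges H φ, e ∈ X.edgeSet} :=
    { toFun := fun f => ⟨f.toEmbedding, fun e he => by
        obtain ⟨a, ha, rfl⟩ := mem_imageEdges.mp he
        exact (f.mapEdgeSet ⟨a, ha⟩).2⟩
      invFun := fun φ => ⟨⟨φ.1, fun {a b} hab =>
        φ.2 s(φ.1 a, φ.1 b) (mem_imageEdges.mpr ⟨s(a, b), hab, rfl⟩)⟩, φ.1.injective⟩
      left_inv := fun _ => rfl
      right_inv := fun _ => rfl }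
  unfold subgraphCount SimpleGraph.labelledCopyCount
  rw [← Fintype.card_subtype]
  simp only [Fintype.card_eq_nat_card]
  exact Nat.card_congr toSub

open Classical in
/-- The number of injections from the vertices of `H` into `{1, …, n}` that send an edge of `H` to
the pair `e`. -/
noncomputable def edgeCount (H : LabelledGraph) (e : Sym2 (Fin n)) : ℕ :=
  (univ.filter fun φ : Fin H.order ↪ Fin n => e ∈ imageEdges H φ).card

theorem imageEdges_trans (H : LabelledGraph) (φ : Fin H.order ↪ Fin n) (σ : Equiv.Perm (Fin n))
    (e : Sym2 (Fin n)) :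
    Sym2.map σ e ∈ imageEdges H (φ.trans σ.toEmbedding) ↔ e ∈ imageEdges H φ := by
  simp only [mem_imageEdges]
  refine exists_congr fun a => and_congr_right fun _ => ?_
  have : Sym2.map (φ.trans σ.toEmbedding) a = Sym2.map σ (Sym2.map φ a) := by
    rw [Sym2.map_map]; rfl
  rw [this]
  exact (Sym2.map.injective σ.injective).eq_iff

theorem edgeCount_eq_edgeCount (H : LabelledGraph) {e f : Sym2 (Fin n)} (he : ¬ e.IsDiag)
    (hf : ¬ f.IsDiag) : edgeCount H e = edgeCount H f := by
  classical
  obtain ⟨σ, rfl⟩ : ∃ σ : Equiv.Perm (Fin n), Sym2.map σ e = f := by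
    induction e using Sym2.ind with | _ a b => ?_
    induction f using Sym2.ind with | _ c d => ?_
    rw [Sym2.mk_isDiag_iff] at he hf
    have hb : Equiv.swap a c b ≠ c := by
      intro h
      rw [Equiv.swap_apply_eq_iff, Equiv.swap_apply_right] at h
      exact he h.symm
    refine ⟨Equiv.swap (Equiv.swap a c b) d * Equiv.swap a c, ?_⟩
    rw [Sym2.map_mk]
    simp [Equiv.swap_apply_of_ne_of_ne hb.symm hf]
  unfold edgeCount
  refine card_nbij' (fun φ => φ.trans σ.toEmbedding) (fun φ => φ.trans σ.symm.toEmbedding)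
    ?_ ?_ ?_ ?_
  · intro φ hφ
    simpa [imageEdges_trans] using hφ
  · intro φ hφ
    have := imageEdges_trans H (φ.trans σ.symm.toEmbedding) σ e
    simp only [coe_filter, mem_univ, true_and, Set.mem_ofPred_eq] at hφ ⊢
    rw [← this]
    convert hφ using 2
    ext a; simp
  · intro φ _
    ext a; simp
  · intro φ _
    ext a; simp

/-- Double counting: by symmetry all pairs are hit equally often. -/
theorem edgeCount_mul_choose (H : LabelledGraph) {e : Sym2 (Fin n)} (he : ¬ e.IsDiag) :
    edgeCount H e * n.choose 2 = H.size * n.descFactorial H.order := by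
  classical
  have h1 : ∑ f ∈ (⊤ : SimpleGraph (Fin n)).edgeFinset, edgeCount H f
      = edgeCount H e * n.choose 2 := by
    rw [sum_congr rfl fun f hf => edgeCount_eq_edgeCount H (f := e) ?_ he, sum_const,
      SimpleGraph.card_edgeFinset_top_eq_card_choose_two, Fintype.card_fin, smul_eq_mul, mul_comm]
    exact (⊤ : SimpleGraph (Fin n)).not_isDiag_of_mem_edgeFinset hf
  rw [← h1]
  unfold edgeCount
  simp_rw [card_filter]
  rw [sum_comm]
  have h2 : ∀ φ : Fin H.order ↪ Fin n, (∑ f ∈ (⊤ : SimpleGraph (Fin n)).edgeFinset,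
      if f ∈ imageEdges H φ then 1 else 0) = H.size := by
    intro φ
    rw [← card_filter, ← card_imageEdges H φ, filter_mem_eq_inter, inter_eq_right.mpr]
    intro f hf
    rw [SimpleGraph.mem_edgeFinset, SimpleGraph.edgeSet_top]
    exact not_isDiag_of_mem_imageEdges hf
  rw [sum_congr rfl fun φ _ => h2 φ, sum_const, card_univ, Fintype.card_embedding_eq,
    Fintype.card_fin, Fintype.card_fin, smul_eq_mul, mul_comm]

/-- Prescribing `|B|` points of the range costs `|B|` powers of `n`. -/
theorem card_embedding_mul_pow_le {m : ℕ} (B : Finset (Fin n)) {U : Finset (Fin m ↪ Fin n)}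
    (hU : ∀ φ ∈ U, ∀ b ∈ B, ∃ a, φ a = b) :
    U.card * n ^ B.card ≤ 2 ^ m * B.card ^ B.card * n ^ m := by
  classical
  have hsub : U.map ⟨fun φ : Fin m ↪ Fin n => (⇑φ : Fin m → Fin n),
      fun _ _ h => DFunLike.coe_injective h⟩ ⊆
      (powersetCard B.card univ).biUnion fun A : Finset (Fin m) =>
        Fintype.piFinset fun v => if v ∈ A then B else univ := by
    intro g hg
    obtain ⟨φ, hφ, rfl⟩ := Finset.mem_map.mp hg
    refine mem_biUnion.mpr ⟨univ.filter fun v => φ v ∈ B, ?_, ?_⟩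
    · refine mem_powersetCard.mpr ⟨subset_univ _, ?_⟩
      rw [← card_map φ]
      congr 1
      ext b
      simp only [Finset.mem_map, mem_filter, mem_univ, true_and]
      constructor
      · rintro ⟨a, ha, rfl⟩
        exact ha
      · intro hb
        obtain ⟨a, rfl⟩ := hU φ hφ b hb
        exact ⟨a, hb, rfl⟩
    · rw [Fintype.mem_piFinset]
      intro v
      split_ifs with h
      · exact (mem_filter.mp h).2
      · exact mem_univ _
  have hcard := (card_le_card hsub).trans card_biUnion_le
  rw [card_map] at hcard
  calc U.card * n ^ B.card
      ≤ (∑ A ∈ powersetCard B.card (univ : Finset (Fin m)),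
          (Fintype.piFinset fun v => if v ∈ A then B else univ).card) * n ^ B.card :=
        Nat.mul_le_mul_right _ hcard
    _ = ∑ A ∈ powersetCard B.card (univ : Finset (Fin m)), B.card ^ B.card * n ^ m := by
        rw [sum_mul]
        refine sum_congr rfl fun A hA => ?_
        have hA := (mem_powersetCard.mp hA).2
        rw [Fintype.card_piFinset]
        simp_rw [apply_ite Finset.card]
        rw [prod_ite, prod_const, prod_const, filter_mem_eq_inter, univ_inter, hA,
          filter_not, filter_mem_eq_inter, univ_inter, card_sdiff_of_subset (subset_univ _), hA,
          card_univ, card_univ, Fintype.card_fin, Fintype.card_fin, mul_assoc, ← pow_add,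
          Nat.sub_add_cancel]
        rw [← hA]
        exact (card_le_univ A).trans_eq (Fintype.card_fin m)
    _ ≤ 2 ^ m * (B.card ^ B.card * n ^ m) := by
        rw [sum_const, card_powersetCard, card_univ, Fintype.card_fin, smul_eq_mul]
        exact Nat.mul_le_mul_right _ (Nat.choose_le_two_pow m _)
    _ = _ := by ring

open Classical in
/-- Two distinct pairs have at least three points, which leaves `m - 3` free vertices. -/
theorem card_pair_mul_pow_le (H : LabelledGraph) {e f : Sym2 (Fin n)} (hef : f ≠ e) :
    (univ.filter fun φ : Fin H.order ↪ Fin n => e ∈ imageEdges H φ ∧ f ∈ imageEdges H φ).card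
      * n ^ 3 ≤ 2 ^ H.order * 27 * n ^ H.order := by
  rcases Finset.eq_empty_or_nonempty
    (univ.filter fun φ : Fin H.order ↪ Fin n => e ∈ imageEdges H φ ∧ f ∈ imageEdges H φ)
    with h | ⟨ψ, hψ⟩
  · rw [h]; simp
  have he := not_isDiag_of_mem_imageEdges (mem_filter.mp hψ).2.1
  have hf := not_isDiag_of_mem_imageEdges (mem_filter.mp hψ).2.2
  obtain ⟨B, hB, hBe⟩ : ∃ B : Finset (Fin n), B.card = 3 ∧ ∀ v ∈ B, v ∈ e ∨ v ∈ f := by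
    clear hψ ψ
    induction e using Sym2.ind with | _ a b => ?_
    induction f using Sym2.ind with | _ c d => ?_
    rw [Sym2.mk_isDiag_iff] at he hf
    by_cases hc : c ∈ ({a, b} : Finset (Fin n))
    · have hd : d ∉ ({a, b} : Finset (Fin n)) := by
        intro hd
        simp only [mem_insert, mem_singleton] at hc hd
        apply hef
        rw [Sym2.eq_iff]
        rcases hc with rfl | rfl <;> rcases hd with rfl | rfl <;> simp_all
      refine ⟨insert d {a, b}, by rw [card_insert_of_notMem hd, card_pair he], ?_⟩
      simp only [mem_insert, mem_singleton, Sym2.mem_iff]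
      tauto
    · refine ⟨insert c {a, b}, by rw [card_insert_of_notMem hc, card_pair he], ?_⟩
      simp only [mem_insert, mem_singleton, Sym2.mem_iff]
      tauto
  have := card_embedding_mul_pow_le B (m := H.order) (U := univ.filter fun φ =>
    e ∈ imageEdges H φ ∧ f ∈ imageEdges H φ) fun φ hφ b hb => by
      have hφ := (mem_filter.mp hφ).2
      exact (hBe b hb).elim (mem_range_of_mem_imageEdges hφ.1) (mem_range_of_mem_imageEdges hφ.2)
  rw [hB] at this
  simpa using this

/-- The normalized number of embeddings through a given pair. -/
noncomputable def edgeDensity (H : LabelledGraph) (n : ℕ) : ℝ :=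
  (H.size : ℝ) * ((n.descFactorial H.order : ℝ) / (n : ℝ) ^ H.order) *
    ((n : ℝ) ^ 2 / (n.choose 2 : ℕ))

theorem edgeCount_div (H : LabelledGraph) {e : Sym2 (Fin n)} (he : ¬ e.IsDiag) (hn : 2 ≤ n) :
    (edgeCount H e : ℝ) / (n : ℝ) ^ ((H.order : ℤ) - 2) = edgeDensity H n := by
  have h := edgeCount_mul_choose H he
  have h : (edgeCount H e : ℝ) * (n.choose 2 : ℕ) = H.size * n.descFactorial H.order := by
    exact_mod_cast h
  have hc : ((n.choose 2 : ℕ) : ℝ) ≠ 0 := by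
    exact_mod_cast (Nat.choose_pos hn).ne'
  have hn0 : (n : ℝ) ≠ 0 := by
    have : n ≠ 0 := by omega
    exact_mod_cast this
  unfold edgeDensity
  rw [zpow_sub₀ hn0, zpow_natCast]
  have : ((n : ℝ) ^ (2 : ℤ)) = (n : ℝ) ^ 2 := by norm_cast
  rw [this]
  field_simp
  linarith

theorem tendsto_edgeDensity (H : LabelledGraph) :
    Tendsto (edgeDensity H) atTop (nhds (2 * H.size)) := by
  have hne : ∀ k : ℕ, ∀ᶠ n : ℕ in atTop, (n : ℝ) ^ k ≠ 0 := fun k =>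
    (eventually_ne_atTop 0).mono fun n hn => pow_ne_zero _ (Nat.cast_ne_zero.mpr hn)
  have h1 : Tendsto (fun n : ℕ => (n.descFactorial H.order : ℝ) / (n : ℝ) ^ H.order) atTop
      (nhds 1) :=
    (Asymptotics.isEquivalent_iff_tendsto_one (hne _)).mp (isEquivalent_descFactorial H.order)
  have h2 : Tendsto (fun n : ℕ => (n : ℝ) ^ 2 / (n.choose 2 : ℕ)) atTop (nhds 2) := by
    have h3 : Tendsto (fun n : ℕ => (n.descFactorial 2 : ℝ) / (n : ℝ) ^ 2) atTop (nhds 1) :=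
      (Asymptotics.isEquivalent_iff_tendsto_one (hne _)).mp (isEquivalent_descFactorial 2)
    have h4 := (h3.inv₀ one_ne_zero).const_mul 2
    rw [inv_one, mul_one] at h4
    refine h4.congr fun n => ?_
    have : (n.descFactorial 2 : ℝ) = 2 * (n.choose 2 : ℕ) := by
      rw [Nat.descFactorial_eq_factorial_mul_choose]
      push_cast
      norm_num
    rw [this, inv_div]
    rw [mul_div_assoc', mul_div_mul_left _ _ two_ne_zero]
  rw [show 2 * (H.size : ℝ) = H.size * 1 * 2 by ring]
  exact (h1.const_mul (H.size : ℝ)).mul h2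

end Embeddings

/-! ### The Hamiltonian as a multilinear polynomial -/

section Hamiltonian

variable {s : ℕ}

/-- The monomials of the Hamiltonian: the injections of the vertices of the graphs `G i`. -/
abbrev Monomial (G : Fin (s + 1) → LabelledGraph) (n : ℕ) : Type :=
  Σ i, Fin (G i).order ↪ Fin n

/-- The coefficient of a monomial of the Hamiltonian. -/
noncomputable def coeff (G : Fin (s + 1) → LabelledGraph) (β : Fin (s + 1) → ℝ) (n : ℕ)
    (j : Monomial G n) : ℝ :=
  β j.1 / (n : ℝ) ^ (((G j.1).order : ℤ) - 2)

/-- The variables in a monomial of the Hamiltonian. -/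
noncomputable def support (G : Fin (s + 1) → LabelledGraph) (n : ℕ) (j : Monomial G n) :
    Finset (Sym2 (Fin n)) :=
  imageEdges (G j.1) j.2

/-- The local field at `e`: the derivative of the Hamiltonian in the variable `e`. -/
noncomputable def field (G : Fin (s + 1) → LabelledGraph) (β : Fin (s + 1) → ℝ) {n : ℕ}
    (e : Sym2 (Fin n)) (x : Sym2 (Fin n) → ℝ) : ℝ :=
  partialDeriv (coeff G β n) (support G n) e x

variable {G : Fin (s + 1) → LabelledGraph} {β : Fin (s + 1) → ℝ} {n : ℕ}

theorem hamiltonian_eq_multilinear (X : SimpleGraph (Fin n)) :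
    hamiltonian G β X = multilinear (coeff G β n) (support G n) (coord X) := by
  classical
  unfold hamiltonian multilinear
  rw [Fintype.sum_sigma]
  refine sum_congr rfl fun i _ => ?_
  rw [subgraphCount_eq, card_filter, mul_div_assoc', mul_div_right_comm]
  push_cast
  rw [mul_sum]
  refine sum_congr rfl fun φ _ => ?_
  simp only [coeff, support, coord, Set.indicator_apply, Pi.one_apply]
  rw [prod_boole]
  congr

theorem hamiltonian_addEdge {X : SimpleGraph (Fin n)} {e : Sym2 (Fin n)} (hd : ¬ e.IsDiag)
    (he : e ∉ X.edgeSet) :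
    hamiltonian G β (addEdge X e) = hamiltonian G β X + field G β e (coord X) := by
  rw [hamiltonian_eq_multilinear, hamiltonian_eq_multilinear, ← sub_eq_iff_eq_add',
    multilinear_sub_multilinear (fun f hf => coord_addEdge_of_ne hd hf) (coord_addEdge_self hd)
      (coord_of_notMem he)]
  exact partialDeriv_congr fun _ _ f _ hf => coord_addEdge_of_ne hd hf

theorem size_edgeGraph_le : edgeGraph.size ≤ 1 := by
  change (⊤ : SimpleGraph (Fin 2)).edgeSet.ncard ≤ 1
  rw [Set.ncard_le_one_iff]
  intro a b ha hb
  induction a using Sym2.ind with | _ a a' => ?_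
  induction b using Sym2.ind with | _ b b' => ?_
  simp only [SimpleGraph.mem_edgeSet, SimpleGraph.top_adj] at ha hb
  rw [Sym2.eq_iff]
  omega

/-- Away from the single edge all coefficients are nonnegative. -/
theorem coeff_nonneg_or (hG : G 0 = edgeGraph) (hβ : ∀ i, i ≠ 0 → 0 ≤ β i) (j : Monomial G n) :
    0 ≤ coeff G β n j ∨ (support G n j).card ≤ 1 := by
  obtain ⟨i, φ⟩ := j
  rcases eq_or_ne i 0 with rfl | hi
  · right
    rw [support, card_imageEdges, hG]
    exact size_edgeGraph_le
  · left
    exact div_nonneg (hβ i hi) (zpow_nonneg (Nat.cast_nonneg n) _)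

theorem field_const {e : Sym2 (Fin n)} (he : ¬ e.IsDiag) (hn : 2 ≤ n) (p : ℝ) :
    field G β e (fun _ => p) = ∑ i, β i * edgeDensity (G i) n * p ^ ((G i).size - 1) := by
  classical
  unfold field partialDeriv
  rw [Fintype.sum_sigma]
  refine sum_congr rfl fun i _ => ?_
  rw [← edgeCount_div (G i) he hn, edgeCount, card_filter]
  push_cast
  rw [mul_div_assoc', mul_div_right_comm, mul_assoc, sum_mul, mul_sum]
  refine sum_congr rfl fun φ _ => ?_
  simp only [support, coeff, prod_const]
  split_ifs with h
  · rw [card_erase_of_mem h, card_imageEdges, one_mul]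
  · simp

/-- Under independent edges of density `p` the mean local field tends to `Ψ p`. -/
theorem eventually_abs_field_const_sub_lt (G : Fin (s + 1) → LabelledGraph) (β : Fin (s + 1) → ℝ)
    (p : ℝ) {ε : ℝ} (hε : 0 < ε) :
    ∀ᶠ n : ℕ in atTop, ∀ e : Sym2 (Fin n), ¬ e.IsDiag →
      |field G β e (fun _ => p) - Psi G β p| < ε := by
  have h : Tendsto (fun n => ∑ i, β i * edgeDensity (G i) n * p ^ ((G i).size - 1)) atTop
      (nhds (Psi G β p)) := by
    have : Psi G β p = ∑ i, β i * (2 * (G i).size) * p ^ ((G i).size - 1) :=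
      sum_congr rfl fun i _ => by ring
    rw [this]
    exact tendsto_finsetSum _ fun i _ =>
      ((tendsto_edgeDensity (G i)).const_mul _).mul_const _
  filter_upwards [(Metric.tendsto_nhds.mp h) ε hε, eventually_ge_atTop 2] with n hn hn2 e he
  rw [field_const he hn2, ← Real.dist_eq]
  exact hn

/-- The field at `e` depends only weakly on each single pair `f`, and boundedly on all of them. -/
theorem exists_pairWeight_le (G : Fin (s + 1) → LabelledGraph) (β : Fin (s + 1) → ℝ) :
    ∃ C : ℝ, 0 < C ∧ ∀ᶠ n : ℕ in atTop, ∀ e : Sym2 (Fin n), ¬ e.IsDiag →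
      (∀ f, pairWeight (coeff G β n) (support G n) e f ≤ C / n) ∧
        ∑ f, pairWeight (coeff G β n) (support G n) e f ≤ C := by
  classical
  set C₁ : ℝ := ∑ i, |β i| * (2 ^ (G i).order * 27) with hC₁
  set C₂ : ℝ := ∑ i, |β i| * (2 * (G i).size + 1) * (G i).size with hC₂
  have hC₁0 : 0 ≤ C₁ := sum_nonneg fun i _ => by positivity
  have hC₂0 : 0 ≤ C₂ := sum_nonneg fun i _ => by positivity
  have hdens : ∀ᶠ n in atTop, ∀ i, edgeDensity (G i) n ≤ 2 * (G i).size + 1 :=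
    eventually_all.mpr fun i =>
      (tendsto_edgeDensity (G i)).eventually_le_const (lt_add_one _)
  refine ⟨C₁ + C₂ + 1, by positivity, ?_⟩
  filter_upwards [hdens, eventually_ge_atTop 2] with n hn hn2 e he
  have hn0 : (0 : ℝ) < n := by exact_mod_cast (by omega : 0 < n)
  have habs : ∀ j : Monomial G n, |coeff G β n j| = |β j.1| / (n : ℝ) ^ (((G j.1).order : ℤ) - 2) :=
    fun j => by rw [coeff, abs_div, abs_of_pos (zpow_pos hn0 _)]
  constructor
  · intro f
    refine le_trans ?_ (div_le_div_of_nonneg_right (by linarith : C₁ ≤ _) hn0.le)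
    rcases eq_or_ne f e with rfl | hef
    · unfold pairWeight
      simp only [notMem_erase, and_false, if_false, sum_const_zero]
      positivity
    unfold pairWeight
    rw [Fintype.sum_sigma, hC₁, sum_div]
    refine sum_le_sum fun i _ => ?_
    have hcount := card_pair_mul_pow_le (G i) hef (n := n)
    set K := (univ.filter fun φ : Fin (G i).order ↪ Fin n =>
      e ∈ imageEdges (G i) φ ∧ f ∈ imageEdges (G i) φ).card with hK
    have hcount : (K : ℝ) * n ^ 3 ≤ 2 ^ (G i).order * 27 * n ^ (G i).order := by
      exact_mod_cast hcount
    have hsum : (∑ φ : Fin (G i).order ↪ Fin n, if e ∈ support G n ⟨i, φ⟩ ∧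
        f ∈ (support G n ⟨i, φ⟩).erase e then |coeff G β n ⟨i, φ⟩| else 0)
        = |β i| * (K / (n : ℝ) ^ (((G i).order : ℤ) - 2)) := by
      rw [hK, card_filter]
      push_cast
      rw [mul_div_assoc', mul_div_right_comm, mul_sum]
      refine sum_congr rfl fun φ _ => ?_
      simp [habs, support, hef]
    rw [hsum, mul_div_assoc]
    refine mul_le_mul_of_nonneg_left ?_ (abs_nonneg _)
    rw [zpow_sub₀ hn0.ne', zpow_natCast, div_div_eq_mul_div,
      div_le_div_iff₀ (by positivity) hn0]
    have : ((n : ℝ) ^ (2 : ℤ)) = (n : ℝ) ^ 2 := by norm_cast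
    rw [this]
    calc (K : ℝ) * n ^ 2 * n = K * n ^ 3 := by ring
      _ ≤ _ := hcount
  · refine le_trans ?_ (by linarith : C₂ ≤ _)
    unfold pairWeight
    rw [sum_comm, Fintype.sum_sigma]
    refine sum_le_sum fun i _ => ?_
    calc ∑ φ : Fin (G i).order ↪ Fin n, ∑ f, (if e ∈ support G n ⟨i, φ⟩ ∧
            f ∈ (support G n ⟨i, φ⟩).erase e then |coeff G β n ⟨i, φ⟩| else 0)
        ≤ ∑ φ : Fin (G i).order ↪ Fin n, (if e ∈ imageEdges (G i) φ then 1 else 0) *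
            (|β i| / (n : ℝ) ^ (((G i).order : ℤ) - 2) * (G i).size) := by
          refine sum_le_sum fun φ _ => ?_
          by_cases h : e ∈ imageEdges (G i) φ
          · simp only [support, h, true_and, if_true, one_mul, habs]
            rw [sum_ite_mem, univ_inter, sum_const, nsmul_eq_mul, mul_comm]
            refine mul_le_mul_of_nonneg_left ?_ (by positivity)
            rw [← card_imageEdges (G i) φ]
            exact_mod_cast card_erase_le
          · simp [support, h]
      _ = |β i| * edgeDensity (G i) n * (G i).size := by
          rw [← sum_mul, ← edgeCount_div (G i) he hn2, edgeCount, card_filter]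
          push_cast
          ring
      _ ≤ |β i| * (2 * (G i).size + 1) * (G i).size := by
          have := hn i
          gcongr

end Hamiltonian

/-! ### The Gibbs measure on a well -/

section Wells

variable {s : ℕ} {G : Fin (s + 1) → LabelledGraph} {β : Fin (s + 1) → ℝ} {n : ℕ}

theorem gibbs_pos (X : SimpleGraph (Fin n)) : 0 < gibbs G β n X :=
  div_pos (Real.exp_pos _) (sum_pos (fun _ _ => Real.exp_pos _) univ_nonempty)

theorem sum_gibbs (G : Fin (s + 1) → LabelledGraph) (β : Fin (s + 1) → ℝ) (n : ℕ) :
    ∑ X, gibbs G β n X = 1 := by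
  unfold gibbs
  rw [← sum_div, div_self]
  exact (sum_pos (fun _ _ => Real.exp_pos _) univ_nonempty).ne'

theorem gibbs_addEdge {X : SimpleGraph (Fin n)} {e : Sym2 (Fin n)} (hd : ¬ e.IsDiag)
    (he : e ∉ X.edgeSet) :
    gibbs G β n (addEdge X e) = gibbs G β n X * Real.exp (field G β e (coord X)) := by
  unfold gibbs
  rw [hamiltonian_addEdge hd he, Real.exp_add, div_mul_eq_mul_div]

theorem phi_pos (p : ℝ) : 0 < phi G β p := by
  unfold phi; positivity

theorem phi_lt_one (p : ℝ) : phi G β p < 1 := by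
  unfold phi
  rw [div_lt_one (by positivity)]
  linarith [Real.exp_pos (Psi G β p)]

theorem one_sub_phi_mul_exp (p : ℝ) : (1 - phi G β p) * Real.exp (Psi G β p) = phi G β p := by
  unfold phi
  field_simp
  ring

open Classical in
/-- The graphs all of whose local fields are at most `a` (for `σ = 1`), or at least `a` (for
`σ = -1`). -/
noncomputable def well (G : Fin (s + 1) → LabelledGraph) (β : Fin (s + 1) → ℝ) (n : ℕ)
    (σ a : ℝ) : Finset (SimpleGraph (Fin n)) :=
  univ.filter fun X => ∀ e : Sym2 (Fin n), ¬ e.IsDiag → σ * field G β e (coord X) ≤ σ * a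

theorem mem_well {σ a : ℝ} {X : SimpleGraph (Fin n)} : X ∈ well G β n σ a ↔
    ∀ e : Sym2 (Fin n), ¬ e.IsDiag → σ * field G β e (coord X) ≤ σ * a := by
  simp [well]

theorem coord_le_coord_addEdge (X : SimpleGraph (Fin n)) {e : Sym2 (Fin n)} (hd : ¬ e.IsDiag)
    (f : Sym2 (Fin n)) : coord X f ≤ coord (addEdge X e) f := by
  rcases eq_or_ne f e with rfl | hf
  · rw [coord_addEdge_self hd]
    exact coord_mem_Icc.2
  · exact (coord_addEdge_of_ne hd hf).ge

theorem field_le_field_addEdge (hG : G 0 = edgeGraph) (hβ : ∀ i, i ≠ 0 → 0 ≤ β i)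
    (X : SimpleGraph (Fin n)) {e : Sym2 (Fin n)} (hd : ¬ e.IsDiag) (f : Sym2 (Fin n)) :
    field G β f (coord X) ≤ field G β f (coord (addEdge X e)) :=
  partialDeriv_mono (coeff_nonneg_or hG hβ) (fun _ => coord_mem_Icc.1)
    (coord_le_coord_addEdge X hd)

open Classical in
/-- Under the Gibbs measure restricted to a well, the conditional probability of an edge, given all
other edges, is at most `φ x` (for `σ = 1`), or at least `φ x` (for `σ = -1`): the wells are
monotone, so that being confined to the well only helps. -/
theorem well_conditional_le (hG : G 0 = edgeGraph) (hβ : ∀ i, i ≠ 0 → 0 ≤ β i) {σ x : ℝ}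
    (hσ : σ = 1 ∨ σ = -1) {X : SimpleGraph (Fin n)} {f : Sym2 (Fin n)} (hf : f ∉ X.edgeSet)
    (hd : ¬ f.IsDiag) :
    σ * ((1 - phi G β x) * (if addEdge X f ∈ well G β n σ (Psi G β x)
        then gibbs G β n (addEdge X f) else 0)
      - phi G β x * (if X ∈ well G β n σ (Psi G β x) then gibbs G β n X else 0)) ≤ 0 := by
  have hφ0 := phi_pos (G := G) (β := β) x
  have hφ1 := phi_lt_one (G := G) (β := β) x
  have hg := gibbs_pos (G := G) (β := β) X
  have hg' := gibbs_pos (G := G) (β := β) (addEdge X f)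
  have hexp := one_sub_phi_mul_exp (G := G) (β := β) x
  have hadd := gibbs_addEdge (G := G) (β := β) hd hf
  rcases hσ with rfl | rfl
  · by_cases h1 : addEdge X f ∈ well G β n 1 (Psi G β x)
    · have h0 : X ∈ well G β n 1 (Psi G β x) := mem_well.mpr fun e he => by
        have := mem_well.mp h1 e he
        have := field_le_field_addEdge hG hβ X hd e
        linarith
      rw [if_pos h1, if_pos h0, hadd]
      have hle : Real.exp (field G β f (coord X)) ≤ Real.exp (Psi G β x) :=
        Real.exp_le_exp.mpr (by have := mem_well.mp h0 f hd; linarith)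
      have := mul_le_mul_of_nonneg_left hle (mul_nonneg (sub_nonneg.mpr hφ1.le) hg.le)
      have h3 := congrArg (gibbs G β n X * ·) hexp
      linarith
    · rw [if_neg h1]
      split_ifs
      · nlinarith
      · simp
  · by_cases h0 : X ∈ well G β n (-1) (Psi G β x)
    · have h1 : addEdge X f ∈ well G β n (-1) (Psi G β x) := mem_well.mpr fun e he => by
        have := mem_well.mp h0 e he
        have := field_le_field_addEdge hG hβ X hd e
        linarith
      rw [if_pos h1, if_pos h0, hadd]
      have hle : Real.exp (Psi G β x) ≤ Real.exp (field G β f (coord X)) :=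
        Real.exp_le_exp.mpr (by have := mem_well.mp h0 f hd; linarith)
      have := mul_le_mul_of_nonneg_left hle (mul_nonneg (sub_nonneg.mpr hφ1.le) hg.le)
      have h3 := congrArg (gibbs G β n X * ·) hexp
      linarith
    · rw [if_neg h0]
      split_ifs
      · nlinarith
      · simp

open Classical in
/-- Inside the well of level `Ψ x` the local fields concentrate below (for `σ = -1`: above) the
level `Ψ (φ x)`, so that its outer shell, beyond any level `b` in between, has exponentially small
relative mass. -/
theorem exists_shell_le (hG : G 0 = edgeGraph) (hβ : ∀ i, i ≠ 0 → 0 ≤ β i) {σ x b : ℝ}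
    (hσ : σ = 1 ∨ σ = -1) (hb : σ * Psi G β (phi G β x) < σ * b) :
    ∃ c : ℝ, 0 < c ∧ ∀ᶠ n : ℕ in atTop,
      ∑ X ∈ well G β n σ (Psi G β x) \ well G β n σ b, gibbs G β n X ≤
        (n : ℝ) ^ 2 * Real.exp (-(c * n)) * ∑ X ∈ well G β n σ (Psi G β x), gibbs G β n X := by
  obtain ⟨C, hC, hCn⟩ := exists_pairWeight_le G β
  set q := phi G β x with hq
  obtain ⟨η, hη, hηb⟩ : ∃ η : ℝ, 0 < η ∧ σ * b = σ * Psi G β q + η :=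
    ⟨σ * b - σ * Psi G β q, sub_pos.mpr hb, by ring⟩
  have hσ2 : σ ^ 2 = 1 := by rcases hσ with rfl | rfl <;> norm_num
  have hσabs : |σ| = 1 := by rcases hσ with rfl | rfl <;> norm_num
  refine ⟨η ^ 2 / (16 * C ^ 2), by positivity, ?_⟩
  filter_upwards [hCn, eventually_abs_field_const_sub_lt G β q (half_pos hη),
    eventually_ge_atTop 1] with n hCn hF hn
  have hn0 : (0 : ℝ) < n := by exact_mod_cast hn
  set W := well G β n σ (Psi G β x) with hW
  set μ : SimpleGraph (Fin n) → ℝ := fun X => if X ∈ W then gibbs G β n X else 0 with hμ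
  have hμ0 : ∀ X, 0 ≤ μ X := fun X => by
    simp only [hμ]
    split_ifs
    exacts [(gibbs_pos X).le, le_rfl]
  have hμsum : ∑ X, μ X = ∑ X ∈ W, gibbs G β n X := by
    simp only [hμ]
    rw [sum_ite_mem, univ_inter]
  -- The optimal Chernoff parameter for fluctuations of variance at most `C ^ 2 / n`.
  set L : ℝ := η * n / (4 * C ^ 2) with hL
  have hL0 : 0 < L := by positivity
  have htail : ∀ e ∈ (⊤ : SimpleGraph (Fin n)).edgeFinset,
      ∑ X, (if σ * b < σ * field G β e (coord X) then μ X else 0) ≤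
        Real.exp (-(η ^ 2 / (16 * C ^ 2) * n)) * ∑ X ∈ W, gibbs G β n X := by
    intro e he
    have hed : ¬ e.IsDiag := (⊤ : SimpleGraph (Fin n)).not_isDiag_of_mem_edgeFinset he
    have hmgf := sum_mul_exp_partialDeriv_le (n := n) (coeff_nonneg_or hG hβ) e hμ0
      (phi_pos (G := G) (β := β) x).le (phi_lt_one (G := G) (β := β) x).le (lam := L * σ)
      (fun X f hf hd => by
        rw [mul_assoc]
        exact mul_nonpos_of_nonneg_of_nonpos hL0.le (well_conditional_le hG hβ hσ hf hd))
      (⊤ : SimpleGraph (Fin n)).edgeFinset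
      (fun f hf => (⊤ : SimpleGraph (Fin n)).not_isDiag_of_mem_edgeFinset hf)
    have hcoord : ∀ X : SimpleGraph (Fin n), partialDeriv (coeff G β n) (support G n) e
        (fun f => if f ∈ (⊤ : SimpleGraph (Fin n)).edgeFinset then coord X f else phi G β x)
        = field G β e (coord X) := fun X =>
      partialDeriv_congr fun j _ f hf _ => if_pos (by
        rw [SimpleGraph.mem_edgeFinset, SimpleGraph.edgeSet_top]
        exact not_isDiag_of_mem_imageEdges hf)
    simp_rw [hcoord] at hmgf
    rw [hμsum] at hmgf
    have hvar : ∑ f ∈ (⊤ : SimpleGraph (Fin n)).edgeFinset,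
        pairWeight (coeff G β n) (support G n) e f ^ 2 ≤ C ^ 2 / n := by
      calc ∑ f ∈ (⊤ : SimpleGraph (Fin n)).edgeFinset,
            pairWeight (coeff G β n) (support G n) e f ^ 2
          ≤ ∑ f, pairWeight (coeff G β n) (support G n) e f ^ 2 :=
            sum_le_univ_sum_of_nonneg fun f => sq_nonneg _
        _ ≤ ∑ f, C / n * pairWeight (coeff G β n) (support G n) e f :=
            sum_le_sum fun f _ => by
              rw [sq]
              exact mul_le_mul_of_nonneg_right ((hCn e hed).1 f) (pairWeight_nonneg e f)
        _ ≤ C / n * C := by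
            rw [← mul_sum]
            exact mul_le_mul_of_nonneg_left (hCn e hed).2 (by positivity)
        _ = C ^ 2 / n := by ring
    have hmean : σ * field G β e (fun _ => q) ≤ σ * Psi G β q + η / 2 := by
      have h1 := hF e hed
      have h2 : σ * (field G β e (fun _ => q) - Psi G β q) ≤ η / 2 := by
        refine (le_abs_self _).trans ?_
        rw [abs_mul, hσabs, one_mul]
        exact h1.le
      linarith
    calc ∑ X, (if σ * b < σ * field G β e (coord X) then μ X else 0)
        ≤ ∑ X, Real.exp (-(L * (σ * b))) *
            (μ X * Real.exp (L * σ * field G β e (coord X))) := by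
          refine sum_le_sum fun X _ => ?_
          have hpos := mul_nonneg (Real.exp_pos (-(L * (σ * b)))).le
            (mul_nonneg (hμ0 X) (Real.exp_pos (L * σ * field G β e (coord X))).le)
          split_ifs with h
          · rw [mul_left_comm, ← Real.exp_add]
            refine le_mul_of_one_le_right (hμ0 X) (Real.one_le_exp ?_)
            have := mul_le_mul_of_nonneg_left h.le hL0.le
            linarith
          · exact hpos
      _ ≤ Real.exp (-(L * (σ * b))) * (Real.exp (L * σ * field G β e (fun _ => q) +
            (L * σ) ^ 2 * (C ^ 2 / n)) * ∑ X ∈ W, gibbs G β n X) := by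
          rw [← mul_sum]
          refine mul_le_mul_of_nonneg_left (hmgf.trans ?_) (Real.exp_pos _).le
          refine mul_le_mul_of_nonneg_right (Real.exp_le_exp.mpr ?_)
            (sum_nonneg fun X _ => (gibbs_pos X).le)
          exact add_le_add le_rfl (mul_le_mul_of_nonneg_left hvar (sq_nonneg _))
      _ ≤ Real.exp (-(η ^ 2 / (16 * C ^ 2) * n)) * ∑ X ∈ W, gibbs G β n X := by
          rw [← mul_assoc, ← Real.exp_add]
          refine mul_le_mul_of_nonneg_right (Real.exp_le_exp.mpr ?_)
            (sum_nonneg fun X _ => (gibbs_pos X).le)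
          rw [hηb, mul_pow, hσ2, mul_one]
          have h1 := mul_le_mul_of_nonneg_left hmean hL0.le
          have h2 : L ^ 2 * (C ^ 2 / n) = η ^ 2 / (16 * C ^ 2) * n := by
            rw [hL]; field_simp; norm_num
          have h3 : L * (η / 2) = 2 * (η ^ 2 / (16 * C ^ 2) * n) := by
            rw [hL]; field_simp; norm_num
          rw [h2]
          linarith
  calc ∑ X ∈ W \ well G β n σ b, gibbs G β n X
      ≤ ∑ X, ∑ e ∈ (⊤ : SimpleGraph (Fin n)).edgeFinset,
          (if σ * b < σ * field G β e (coord X) then μ X else 0) := by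
        have hnn : ∀ X, ∀ e ∈ (⊤ : SimpleGraph (Fin n)).edgeFinset,
            0 ≤ (if σ * b < σ * field G β e (coord X) then μ X else 0) := fun X e _ => by
          split_ifs
          exacts [hμ0 X, le_rfl]
        refine le_trans (sum_le_sum fun X hX => ?_)
          (sum_le_univ_sum_of_nonneg fun X => sum_nonneg (hnn X))
        obtain ⟨hXW, hXb⟩ := mem_sdiff.mp hX
        rw [mem_well] at hXb
        push Not at hXb
        obtain ⟨e, hed, he⟩ := hXb
        have heT : e ∈ (⊤ : SimpleGraph (Fin n)).edgeFinset := by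
          rw [SimpleGraph.mem_edgeFinset, SimpleGraph.edgeSet_top]
          exact hed
        refine le_trans (le_of_eq ?_) (single_le_sum (hnn X) heT)
        rw [if_pos he]
        exact (if_pos hXW).symm
    _ ≤ ∑ e ∈ (⊤ : SimpleGraph (Fin n)).edgeFinset,
          Real.exp (-(η ^ 2 / (16 * C ^ 2) * n)) * ∑ X ∈ W, gibbs G β n X := by
        rw [sum_comm]
        exact sum_le_sum htail
    _ ≤ (n : ℝ) ^ 2 * Real.exp (-(η ^ 2 / (16 * C ^ 2) * n)) * ∑ X ∈ W, gibbs G β n X := by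
        rw [sum_const, SimpleGraph.card_edgeFinset_top_eq_card_choose_two, Fintype.card_fin,
          nsmul_eq_mul, ← mul_assoc]
        refine mul_le_mul_of_nonneg_right ?_ (sum_nonneg fun X _ => (gibbs_pos X).le)
        refine mul_le_mul_of_nonneg_right ?_ (Real.exp_pos _).le
        exact_mod_cast Nat.choose_le_pow n 2

theorem sum_abs_coord_sub (X Y : SimpleGraph (Fin n)) :
    ∑ f, |coord X f - coord Y f| = edgeDist X Y := by
  classical
  have h : (symmDiff X.edgeSet Y.edgeSet).toFinset
      = univ.filter fun f => f ∈ symmDiff X.edgeSet Y.edgeSet := by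
    ext f; simp [Set.mem_symmDiff, Finset.mem_symmDiff]
  rw [edgeDist, Set.ncard_eq_toFinset_card', h, card_filter]
  push_cast
  refine sum_congr rfl fun f _ => ?_
  unfold coord
  by_cases hX : f ∈ X.edgeSet <;> by_cases hY : f ∈ Y.edgeSet <;>
    simp [hX, hY, Set.mem_symmDiff]

/-- A local chain cannot jump over the shell between two levels of a well. -/
theorem IsLocal.eventually_mem_well
    {P : (n : ℕ) → Matrix (SimpleGraph (Fin n)) (SimpleGraph (Fin n)) ℝ} (hP : IsLocal P)
    {σ a b : ℝ} (hσ : σ = 1 ∨ σ = -1) (hab : σ * b < σ * a) :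
    ∀ᶠ n in atTop, ∀ X ∈ well G β n σ b, ∀ Y, P n X Y ≠ 0 → Y ∈ well G β n σ a := by
  obtain ⟨C, hC, hCn⟩ := exists_pairWeight_le G β
  obtain ⟨k, hk, hkP⟩ := hP
  have hη : 0 < (σ * a - σ * b) / C := div_pos (sub_pos.mpr hab) hC
  have hσabs : |σ| = 1 := by rcases hσ with rfl | rfl <;> norm_num
  filter_upwards [hCn, hkP, hk.def hη, eventually_ge_atTop 1] with n hCn hkP hk hn X hX Y hXY
  have hn0 : (0 : ℝ) < n := by exact_mod_cast hn
  rw [Real.norm_natCast, Real.norm_natCast] at hk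
  refine mem_well.mpr fun e he => ?_
  have h1 : |field G β e (coord Y) - field G β e (coord X)| ≤ σ * a - σ * b := by
    calc |field G β e (coord Y) - field G β e (coord X)|
        ≤ ∑ f, |coord Y f - coord X f| * pairWeight (coeff G β n) (support G n) e f :=
          abs_partialDeriv_sub_le e (fun _ => coord_mem_Icc) (fun _ => coord_mem_Icc)
      _ ≤ ∑ f, |coord Y f - coord X f| * (C / n) :=
          sum_le_sum fun f _ => mul_le_mul_of_nonneg_left ((hCn e he).1 f) (abs_nonneg _)
      _ = edgeDist X Y * (C / n) := by
          rw [← sum_mul]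
          simp_rw [abs_sub_comm (coord Y _)]
          rw [sum_abs_coord_sub]
      _ ≤ ((σ * a - σ * b) / C * n) * (C / n) := by
          refine mul_le_mul_of_nonneg_right (le_trans ?_ hk) (by positivity)
          exact_mod_cast hkP X Y hXY
      _ = σ * a - σ * b := by field_simp
  have h2 : σ * (field G β e (coord Y) - field G β e (coord X)) ≤ σ * a - σ * b := by
    refine (le_abs_self _).trans ?_
    rwa [abs_mul, hσabs, one_mul]
  have h3 := mem_well.mp hX e he
  linarith

/-- The empty graph lies in the lower well, the complete graph in the upper one. -/
theorem eventually_well_nonempty {σ a : ℝ}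
    (h : (σ = 1 ∧ Psi G β 0 < a) ∨ (σ = -1 ∧ a < Psi G β 1)) :
    ∀ᶠ n in atTop, (well G β n σ a).Nonempty := by
  rcases h with ⟨rfl, h⟩ | ⟨rfl, h⟩
  · filter_upwards [eventually_abs_field_const_sub_lt G β 0 (sub_pos.mpr h)] with n hn
    refine ⟨⊥, mem_well.mpr fun e he => ?_⟩
    have hc : field G β e (coord (⊥ : SimpleGraph (Fin n))) = field G β e (fun _ => 0) :=
      partialDeriv_congr fun _ _ f _ _ => coord_of_notMem (by simp)
    rw [hc]
    linarith [(abs_lt.mp (hn e he)).2]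
  · filter_upwards [eventually_abs_field_const_sub_lt G β 1 (sub_pos.mpr h)] with n hn
    refine ⟨⊤, mem_well.mpr fun e he => ?_⟩
    have hc : field G β e (coord (⊤ : SimpleGraph (Fin n))) = field G β e (fun _ => 1) :=
      partialDeriv_congr fun _ _ f hf _ => coord_of_mem (by
        rw [SimpleGraph.edgeSet_top]
        exact not_isDiag_of_mem_imageEdges hf)
    rw [hc]
    linarith [(abs_lt.mp (hn e he)).1]

/-- A local chain needs an exponential time to leave a well of Gibbs mass at most `1/2`. -/
theorem exists_exp_le_mixingTime (hG : G 0 = edgeGraph) (hβ : ∀ i, i ≠ 0 → 0 ≤ β i) {σ x : ℝ}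
    (hσ : (σ = 1 ∧ Psi G β 0 < Psi G β x) ∨ (σ = -1 ∧ Psi G β x < Psi G β 1))
    (hx : σ * Psi G β (phi G β x) < σ * Psi G β x) :
    ∃ c : ℝ, 0 < c ∧ ∀ P : (n : ℕ) → Matrix (SimpleGraph (Fin n)) (SimpleGraph (Fin n)) ℝ,
      (∀ᶠ n in atTop, IsTransitionMatrix (P n) ∧ IsStationary (P n) (gibbs G β n)) →
      IsLocal P → ∀ᶠ n : ℕ in atTop,
        ∑ X ∈ well G β n σ (Psi G β x), gibbs G β n X ≤ 1 / 2 →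
          ENNReal.ofReal (Real.exp (c * n)) ≤ (mixingTime (P n) (gibbs G β n) : ENNReal) := by
  classical
  have hσ' : σ = 1 ∨ σ = -1 := hσ.imp And.left And.left
  obtain ⟨b, hb1, hb2⟩ : ∃ b, σ * Psi G β (phi G β x) < σ * b ∧ σ * b < σ * Psi G β x :=
    ⟨(Psi G β (phi G β x) + Psi G β x) / 2, by linarith, by linarith⟩
  obtain ⟨c, hc, hshell⟩ := exists_shell_le hG hβ hσ' hb1
  refine ⟨c / 2, half_pos hc, fun P hP hloc => ?_⟩
  have he : 0 < 1 / 2 - Real.exp (-1) := by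
    have h2 : (2 : ℝ) < Real.exp 1 := by linarith [Real.exp_one_gt_d9]
    have := (inv_lt_inv₀ (Real.exp_pos 1) two_pos).mpr h2
    rw [Real.exp_neg]
    linarith
  have hsmall : ∀ᶠ n : ℕ in atTop,
      (n : ℝ) ^ 2 * Real.exp (-(c / 2 * n)) < 1 / 2 - Real.exp (-1) := by
    have h := (tendsto_rpow_mul_exp_neg_mul_atTop_nhds_zero 2 (c / 2) (half_pos hc)).comp
      tendsto_natCast_atTop_atTop
    filter_upwards [h.eventually_lt_const he] with n hn
    simpa [neg_mul] using hn
  filter_upwards [hP, hloc.eventually_mem_well (G := G) (β := β) hσ' hb2, hshell, hsmall,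
    eventually_well_nonempty hσ] with n hPn hlocn hshelln hsmalln hne hhalf
  refine ofReal_le_mixingTime fun t ht => ?_
  have hbar := le_mul_of_barrier hPn.1 hPn.2 (fun X => (gibbs_pos X).le) (sum_gibbs G β n)
    (A := well G β n σ (Psi G β x)) (B := well G β n σ (Psi G β x) \ well G β n σ b)
    (fun X hXA hXB Y hXY => hlocn X (by simpa [hXA] using hXB) Y hXY)
    (sum_pos (fun X _ => gibbs_pos X) hne) hhalf hshelln (t := t) (fun X => by convert ht X)
  have hsplit : Real.exp (-(c * n)) = Real.exp (-(c / 2 * n)) * Real.exp (-(c / 2 * n)) := by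
    rw [← Real.exp_add]; ring_nf
  have h1 : 1 / 2 - Real.exp (-1) ≤
      (t * Real.exp (-(c / 2 * n))) * ((n : ℝ) ^ 2 * Real.exp (-(c / 2 * n))) := by
    rw [hsplit] at hbar
    linarith
  have h2 : 1 ≤ t * Real.exp (-(c / 2 * n)) := by
    by_contra hlt
    push Not at hlt
    have := mul_le_mul_of_nonneg_right hlt.le
      (by positivity : 0 ≤ (n : ℝ) ^ 2 * Real.exp (-(c / 2 * n)))
    linarith
  rw [Real.exp_neg, ← div_eq_mul_inv, one_le_div (Real.exp_pos _)] at h2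
  exact h2

end Wells

/-! ### The Glauber dynamics -/

section Glauber

variable {s : ℕ} {G : Fin (s + 1) → LabelledGraph} {β : Fin (s + 1) → ℝ} {n : ℕ}

theorem isTransitionMatrix_glauber (hn : 2 ≤ n) : IsTransitionMatrix (glauber G β n) := by
  classical
  have hg : ∀ X : SimpleGraph (Fin n), 0 < gibbs G β n X := gibbs_pos
  refine ⟨fun X Y => ?_, fun X => ?_⟩
  · refine mul_nonneg (by positivity) (sum_nonneg fun e _ => add_nonneg ?_ ?_)
    · split_ifs
      · exact div_nonneg (hg _).le (add_pos (hg _) (hg _)).le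
      · exact le_rfl
    · split_ifs
      · exact div_nonneg (hg _).le (add_pos (hg _) (hg _)).le
      · exact le_rfl
  · unfold glauber
    rw [← mul_sum, sum_comm]
    simp_rw [sum_add_distrib, sum_ite_eq', mem_univ, if_true]
    have h1 : ∀ e : Sym2 (Fin n),
        gibbs G β n (addEdge X e) / (gibbs G β n (addEdge X e) + gibbs G β n (removeEdge X e)) +
          gibbs G β n (removeEdge X e) /
            (gibbs G β n (addEdge X e) + gibbs G β n (removeEdge X e)) = 1 := fun e => by
      rw [← add_div, div_self (add_pos (hg _) (hg _)).ne']
    rw [← sum_add_distrib, sum_congr rfl fun e _ => h1 e, sum_const,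
      SimpleGraph.card_edgeFinset_top_eq_card_choose_two, Fintype.card_fin, nsmul_eq_mul, mul_one,
      inv_mul_cancel₀]
    exact_mod_cast (Nat.choose_pos hn).ne'

/-- Updating a single edge preserves the Gibbs measure. -/
theorem isStationary_glauber (hn : 2 ≤ n) : IsStationary (glauber G β n) (gibbs G β n) := by
  classical
  intro Y
  have hedge : ∀ e ∈ (⊤ : SimpleGraph (Fin n)).edgeFinset, ∑ X, gibbs G β n X *
      ((if Y = addEdge X e then
        gibbs G β n (addEdge X e) / (gibbs G β n (addEdge X e) + gibbs G β n (removeEdge X e))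
      else 0) +
     (if Y = removeEdge X e then
        gibbs G β n (removeEdge X e) / (gibbs G β n (addEdge X e) + gibbs G β n (removeEdge X e))
      else 0)) = gibbs G β n Y := by
    intro e he
    have hd : ¬ e.IsDiag := (⊤ : SimpleGraph (Fin n)).not_isDiag_of_mem_edgeFinset he
    have hY : gibbs G β n Y = ∑ X, if Y = X then gibbs G β n X else 0 := by simp
    rw [hY, sum_eq_sum_pair hd, sum_eq_sum_pair hd]
    refine sum_congr rfl fun X hX => ?_
    have hX : e ∉ X.edgeSet := (mem_filter.mp hX).2
    have h1 : addEdge (addEdge X e) e = addEdge X e :=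
      addEdge_of_mem (by rw [edgeSet_addEdge hd]; exact Set.mem_insert _ _)
    rw [h1, removeEdge_addEdge hd hX, removeEdge_of_notMem hX, ← add_mul]
    have hpos := add_pos (gibbs_pos (G := G) (β := β) (addEdge X e))
      (gibbs_pos (G := G) (β := β) X)
    rw [mul_add]
    congr 1
    · split_ifs
      · field_simp
      · simp
    · split_ifs
      · field_simp
      · simp
  unfold glauber
  rw [sum_congr rfl fun X _ => (mul_left_comm _ _ _).trans (congrArg _ (mul_sum _ _ _)),
    ← mul_sum, sum_comm, sum_congr rfl hedge, sum_const,
    SimpleGraph.card_edgeFinset_top_eq_card_choose_two, Fintype.card_fin, nsmul_eq_mul,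
    ← mul_assoc, inv_mul_cancel₀, one_mul]
  exact_mod_cast (Nat.choose_pos hn).ne'

theorem isLocal_glauber (G : Fin (s + 1) → LabelledGraph) (β : Fin (s + 1) → ℝ) :
    IsLocal (glauber G β) := by
  classical
  refine ⟨fun _ => 1, ?_, Eventually.of_forall fun n X Y hXY => ?_⟩
  · simp only [Nat.cast_one]
    exact (Asymptotics.isLittleO_const_id_atTop (1 : ℝ)).comp_tendsto tendsto_natCast_atTop_atTop
  · obtain ⟨e, he, hne⟩ := exists_ne_zero_of_sum_ne_zero (right_ne_zero_of_mul hXY)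
    have hd : ¬ e.IsDiag := (⊤ : SimpleGraph (Fin n)).not_isDiag_of_mem_edgeFinset he
    have hY : Y = addEdge X e ∨ Y = removeEdge X e := by
      by_contra h
      push Not at h
      simp [h.1, h.2] at hne
    have hsub : symmDiff X.edgeSet Y.edgeSet ⊆ {e} := by
      intro f hf
      rcases hY with rfl | rfl
      · rw [edgeSet_addEdge hd, Set.mem_symmDiff, Set.mem_insert_iff] at hf
        rw [Set.mem_singleton_iff]
        tauto
      · rw [edgeSet_removeEdge, Set.mem_symmDiff, Set.mem_sdiff] at hf
        tauto
    exact (Set.ncard_le_ncard hsub).trans_eq (Set.ncard_singleton e)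

end Glauber

/-! ### Low temperature -/

section LowTemperature

variable {s : ℕ} {G : Fin (s + 1) → LabelledGraph} {β : Fin (s + 1) → ℝ}

/-- `Ψ` is strictly increasing on `[0, ∞)` unless it is constant. -/
theorem strictMonoOn_Psi (hG : G 0 = edgeGraph) (hβ : ∀ i, i ≠ 0 → 0 ≤ β i) {x y : ℝ}
    (hxy : Psi G β x ≠ Psi G β y) : StrictMonoOn (Psi G β) (Set.Ici 0) := by
  obtain ⟨i, hi, hsize⟩ : ∃ i, 0 < β i ∧ 2 ≤ (G i).size := by
    by_contra h
    push Not at h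
    refine hxy (sum_congr rfl fun i _ => ?_)
    have hle : (G i).size ≤ 1 ∨ β i = 0 := by
      rcases eq_or_ne i 0 with rfl | hi
      · left; rw [hG]; exact size_edgeGraph_le
      · rcases (hβ i hi).eq_or_lt with h0 | h0
        · exact .inr h0.symm
        · exact .inl (by have := h i h0; omega)
    rcases hle with h1 | h1
    · rw [Nat.sub_eq_zero_of_le h1, pow_zero, pow_zero]
    · simp [h1]
  intro p hp q _ hpq
  refine sum_lt_sum (fun j _ => ?_) ⟨i, mem_univ i, ?_⟩
  · rcases eq_or_ne j 0 with rfl | hj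
    · rw [Nat.sub_eq_zero_of_le (by rw [hG]; exact size_edgeGraph_le), pow_zero, pow_zero]
    · have := hβ j hj
      have := pow_le_pow_left₀ hp hpq.le ((G j).size - 1)
      exact mul_le_mul_of_nonneg_left this (by positivity)
  · have h1 : 0 < ((G i).size : ℝ) := by exact_mod_cast (by omega : 0 < (G i).size)
    exact mul_lt_mul_of_pos_left (pow_lt_pow_left₀ hpq hp (by omega)) (by positivity)

theorem differentiable_phi : Differentiable ℝ (phi G β) := by
  have hΨ : Differentiable ℝ (Psi G β) := by
    unfold Psi
    fun_prop
  unfold phi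
  exact hΨ.exp.div (hΨ.exp.const_add 1) fun x => by positivity

/-- Next to a stable fixed point the graph of `φ` lies below the diagonal on the right and above it
on the left. -/
theorem eventually_phi_sub_div_lt {p : ℝ} (hp : phi G β p = p) (hd : deriv (phi G β) p < 1) :
    ∀ᶠ x in nhdsWithin p {p}ᶜ, (phi G β x - p) / (x - p) < 1 := by
  have h := hasDerivAt_iff_tendsto_slope.mp (differentiable_phi (G := G) (β := β) p).hasDerivAt
  filter_upwards [h.eventually_lt_const hd] with x hx
  rwa [slope_def_field, hp] at hx

theorem exists_lt_phi_lt {p m : ℝ} (hpm : p < m) (hp : phi G β p = p)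
    (hd : deriv (phi G β) p < 1) : ∃ x ∈ Set.Ioo p m, phi G β x < x := by
  have h := (eventually_phi_sub_div_lt hp hd).filter_mono
    (nhdsWithin_mono p fun x (hx : x ∈ Set.Ioi p) => (ne_of_gt hx : x ≠ p))
  obtain ⟨x, hx, hxm⟩ := (h.and (Ioo_mem_nhdsGT hpm)).exists
  rw [div_lt_one (sub_pos.mpr hxm.1)] at hx
  exact ⟨x, hxm, by linarith⟩

theorem exists_gt_lt_phi {p m : ℝ} (hmp : m < p) (hp : phi G β p = p)
    (hd : deriv (phi G β) p < 1) : ∃ x ∈ Set.Ioo m p, x < phi G β x := by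
  have h := (eventually_phi_sub_div_lt hp hd).filter_mono
    (nhdsWithin_mono p fun x (hx : x ∈ Set.Iio p) => (ne_of_lt hx : x ≠ p))
  obtain ⟨x, hx, hxm⟩ := (h.and (Ioo_mem_nhdsLT hmp)).exists
  rw [div_lt_one_of_neg (sub_neg.mpr hxm.2)] at hx
  exact ⟨x, hxm, by linarith⟩

/-- At low temperature there are levels `x < y` at which `φ` points down and up, respectively. -/
theorem LowTemperature.exists_levels (hlow : LowTemperature G β) :
    ∃ p₁ p₂ x y, 0 < x ∧ x < y ∧ y < 1 ∧ phi G β x < x ∧ y < phi G β y ∧ p₁ < p₂ ∧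
      phi G β p₁ = p₁ ∧ phi G β p₂ = p₂ := by
  obtain ⟨p₁, ⟨hp1I, hp1, hd1⟩, p₂, ⟨hp2I, hp2, hd2⟩, hlt⟩ := hlow.exists_lt
  obtain ⟨x, hx, hφx⟩ := exists_lt_phi_lt (m := (p₁ + p₂) / 2) (by linarith) hp1 hd1
  obtain ⟨y, hy, hφy⟩ := exists_gt_lt_phi (m := (p₁ + p₂) / 2) (by linarith) hp2 hd2
  exact ⟨p₁, p₂, x, y, hp1I.1.trans_lt hx.1, hx.2.trans hy.1, hy.2.trans_le hp2I.2, hφx, hφy,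
    hlt, hp1, hp2⟩

end LowTemperature

/-- The two wells are disjoint, so one of them has Gibbs mass at most `1/2`. -/
theorem exists_exp_le_mixingTime_of_lowTemperature {s : ℕ} {G : Fin (s + 1) → LabelledGraph}
    {β : Fin (s + 1) → ℝ} (hG : G 0 = edgeGraph) (hβ : ∀ i, i ≠ 0 → 0 ≤ β i)
    (hlow : LowTemperature G β) :
    ∃ c : ℝ, 0 < c ∧ ∀ P : (n : ℕ) → Matrix (SimpleGraph (Fin n)) (SimpleGraph (Fin n)) ℝ,
      (∀ᶠ n in atTop, IsTransitionMatrix (P n) ∧ IsStationary (P n) (gibbs G β n)) →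
      IsLocal P → ∀ᶠ n : ℕ in atTop,
        ENNReal.ofReal (Real.exp (c * n)) ≤ (mixingTime (P n) (gibbs G β n) : ENNReal) := by
  classical
  obtain ⟨p₁, p₂, x, y, hx0, hxy, hy1, hφx, hφy, hlt, hp1, hp2⟩ := hlow.exists_levels
  have hne : Psi G β p₁ ≠ Psi G β p₂ := by
    intro h
    have : phi G β p₁ = phi G β p₂ := by unfold phi; rw [h]
    linarith
  have hmono := strictMonoOn_Psi hG hβ hne
  have hy0 : 0 < y := hx0.trans hxy
  obtain ⟨c₁, hc₁, h₁⟩ := exists_exp_le_mixingTime hG hβ (σ := 1) (x := x)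
    (.inl ⟨rfl, hmono (Set.mem_Ici.mpr le_rfl) hx0.le hx0⟩) (by
      rw [one_mul, one_mul]
      exact hmono (phi_pos x).le hx0.le hφx)
  obtain ⟨c₂, hc₂, h₂⟩ := exists_exp_le_mixingTime hG hβ (σ := -1) (x := y)
    (.inr ⟨rfl, hmono hy0.le (Set.mem_Ici.mpr zero_le_one) hy1⟩) (by
      have : Psi G β y < Psi G β (phi G β y) := hmono hy0.le (phi_pos y).le hφy
      linarith)
  refine ⟨min c₁ c₂, lt_min hc₁ hc₂, fun P hP hloc => ?_⟩
  filter_upwards [h₁ P hP hloc, h₂ P hP hloc, eventually_ge_atTop 2] with n hn₁ hn₂ hn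
  have hdisj : Disjoint (well G β n 1 (Psi G β x)) (well G β n (-1) (Psi G β y)) := by
    rw [Finset.disjoint_left]
    intro X hX hY
    have he : ¬ (s(⟨0, by omega⟩, ⟨1, by omega⟩) : Sym2 (Fin n)).IsDiag := by
      simp [Sym2.mk_isDiag_iff]
    have h1 := mem_well.mp hX _ he
    have h2 := mem_well.mp hY _ he
    have h3 : Psi G β x < Psi G β y := hmono hx0.le hy0.le hxy
    linarith
  have hsum : ∑ X ∈ well G β n 1 (Psi G β x), gibbs G β n X +
      ∑ X ∈ well G β n (-1) (Psi G β y), gibbs G β n X ≤ 1 := by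
    rw [← sum_union hdisj, ← sum_gibbs G β n]
    exact sum_le_univ_sum_of_nonneg fun X => (gibbs_pos X).le
  have hmin : ∀ c, min c₁ c₂ ≤ c → ENNReal.ofReal (Real.exp (min c₁ c₂ * n)) ≤
      ENNReal.ofReal (Real.exp (c * n)) := fun c hc =>
    ENNReal.ofReal_le_ofReal (Real.exp_le_exp.mpr
      (mul_le_mul_of_nonneg_right hc (Nat.cast_nonneg n)))
  rcases le_or_gt (∑ X ∈ well G β n 1 (Psi G β x), gibbs G β n X) (1 / 2) with h | h
  · exact (hmin c₁ (min_le_left _ _)).trans (hn₁ h)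
  · exact (hmin c₂ (min_le_right _ _)).trans (hn₂ (by linarith))

end ERGM

theorem theorem2 {s : ℕ} (G : Fin (s + 1) → ERGM.LabelledGraph) (β : Fin (s + 1) → ℝ)
    (hG : G 0 = ERGM.edgeGraph) (hβ : ∀ i, i ≠ 0 → 0 ≤ β i)
    (hlow : ERGM.LowTemperature G β) :
    ∃ c : ℝ, 0 < c ∧
      (∀ᶠ n : ℕ in Filter.atTop,
        ENNReal.ofReal (Real.exp (c * n)) ≤
          (ERGM.mixingTime (ERGM.glauber G β n) (ERGM.gibbs G β n) : ENNReal)) ∧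
      ∀ P : (n : ℕ) → Matrix (SimpleGraph (Fin n)) (SimpleGraph (Fin n)) ℝ,
        (∀ᶠ n in Filter.atTop,
          ERGM.IsTransitionMatrix (P n) ∧ ERGM.IsStationary (P n) (ERGM.gibbs G β n)) →
        ERGM.IsLocal P →
        ∀ᶠ n : ℕ in Filter.atTop,
          ENNReal.ofReal (Real.exp (c * n)) ≤
            (ERGM.mixingTime (P n) (ERGM.gibbs G β n) : ENNReal) := by
  obtain ⟨c, hc, h⟩ := ERGM.exists_exp_le_mixingTime_of_lowTemperature hG hβ hlow
  refine ⟨c, hc, h _ ?_ (ERGM.isLocal_glauber G β), h⟩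
  filter_upwards [Filter.eventually_ge_atTop 2] with n hn
  exact ⟨ERGM.isTransitionMatrix_glauber hn, ERGM.isStationary_glauber hn⟩
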